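/- \textbf{Theorem.} Let $X$ be a separable metric space that is \emph{homogeneous} (for any two points $p,q\in X$ some homeomorphism of $X$ onto itself maps $p$ to $q$) and \emph{locally conical} (every point of $X$ has an open neighborhood homeomorphic to the open cone over some compact space $Y$). Here the open cone over $Y$ is the quotient space $\bigl(Y\times[0,\infty)\bigr)/\bigl(Y\times\{0\}\bigr)$, and the open cone over the empty space is understood to be a single point. \begin{enumerate} \item If $X$ is connected and is not a $1$-manifold (without boundary), then for every integer $n\ge 2$ the space $X$ is \emph{strongly $n$-homogeneous}: every bijection between two $n$-element subsets of $X$ extends to a homeomorphism of $X$ onto itself. \item Whether or not $X$ is connected, and whether or not it is a $1$-manifold, $X$ is \emph{countable dense homogeneous}: for any two countable dense subsets $A$ and $B$ of $X$ there is a homeomorphism of $X$ onto itself that maps $A$ onto $B$. \end{enumerate} -/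

import Mathlib

open scoped NNReal

universe u

/-- The points of `(Y × [0, ∞)) ⊔ {∗}` that become the vertex of the open cone over `Y`:
all the points `(y, 0)`, together with `∗`. -/
def openConeVertexSet (Y : Type u) : Set ((Y × ℝ≥0) ⊕ Unit) :=
  {a | (∃ y : Y, a = Sum.inl (y, 0)) ∨ a = Sum.inr ()}

/-- The equivalence relation on `(Y × [0, ∞)) ⊔ {∗}` that collapses the vertex set to a point
and identifies nothing else. -/
def openConeSetoid (Y : Type u) : Setoid ((Y × ℝ≥0) ⊕ Unit) where
  r a b := a = b ∨ (a ∈ openConeVertexSet Y ∧ b ∈ openConeVertexSet Y)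
  iseqv :=
    { refl := fun _ => Or.inl rfl
      symm := by
        rintro a b (h | ⟨ha, hb⟩)
        · exact Or.inl h.symm
        · exact Or.inr ⟨hb, ha⟩
      trans := by
        rintro a b c (rfl | ⟨ha, hb⟩) (rfl | ⟨hb', hc⟩)
        · exact Or.inl rfl
        · exact Or.inr ⟨hb', hc⟩
        · exact Or.inr ⟨ha, hb⟩
        · exact Or.inr ⟨ha, hc⟩ }

/-- The open cone over a space `Y`. For nonempty `Y` it is the quotient
`Y × [0, ∞) / Y × {0}` (equivalently `Y × (0, ∞] / Y × {∞}`, by `t ↦ 1 / t`).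
The extra point `∗`, which is glued to the vertex, only matters for empty `Y`:
the open cone over the empty space is one point. -/
def OpenCone (Y : Type u) : Type u :=
  Quotient (openConeSetoid Y)

/-- The open cone carries the quotient topology. -/
instance OpenCone.instTopologicalSpace (Y : Type u) [TopologicalSpace Y] :
    TopologicalSpace (OpenCone Y) :=
  inferInstanceAs (TopologicalSpace (Quotient (openConeSetoid Y)))

/-- Every point has an open neighborhood homeomorphic to the open cone over a compact space
(the point need not be the vertex). If `X` is metrizable then so is every such compact space `Y`,
since `Y` embeds in `X` as a level `Y × {1}` of the cone; in particular looking for `Y` in the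
universe of `X` is no restriction. -/
def IsLocallyConical (X : Type u) [TopologicalSpace X] : Prop :=
  ∀ x : X, ∃ U : Set X, IsOpen U ∧ x ∈ U ∧
    ∃ (Y : Type u) (_ : TopologicalSpace Y), CompactSpace Y ∧ Nonempty (U ≃ₜ OpenCone Y)

/-- Any point can be moved to any other point by a self-homeomorphism. -/
def IsHomogeneousSpace (X : Type u) [TopologicalSpace X] : Prop :=
  ∀ p q : X, ∃ h : X ≃ₜ X, h p = q

/-- Every bijection between two `n`-element subsets extends to a self-homeomorphism. -/
def IsStronglyHomogeneous (n : ℕ) (X : Type u) [TopologicalSpace X] : Prop :=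
  ∀ A B : Finset X, A.card = n → B.card = n → ∀ f : A ≃ B, ∃ h : X ≃ₜ X, ∀ a : A, h a = f a

/-- Any countable dense subset can be mapped onto any other one by a self-homeomorphism. -/
def IsCountableDenseHomogeneous (X : Type u) [TopologicalSpace X] : Prop :=
  ∀ A B : Set X, A.Countable → Dense A → B.Countable → Dense B → ∃ h : X ≃ₜ X, h '' A = B

/-- A topological 1-manifold (without boundary): Hausdorff, second countable, and
covered by charts onto open subsets of `ℝ`. -/
def IsOneManifold (X : Type u) [TopologicalSpace X] : Prop :=
  T2Space X ∧ SecondCountableTopology X ∧ Nonempty (ChartedSpace ℝ X)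

open Topology Filter Set
open scoped ENNReal

/-! Both parts rest on strong local homogeneity: a point can be moved to every sufficiently near
point by a homeomorphism supported in a prescribed neighborhood. Since X is locally compact, it is
Polish and carries a complete metric. Countable dense homogeneity is then a back-and-forth
construction with convergent products of small homeomorphisms.

To get strong local homogeneity, note that by homogeneity every point is the vertex of a cone chart
over one fixed `Y`. The chart gives compact balls around the point and homeomorphisms contracting
them (`RadialStructure`). If the balls around p and q interleave at three pairs of levels, an
infinite swindle moves p to q (`MovesWithin.of_swindle`, `RadialStructure.movesWithin`). The
interleaving is witnessed by three members of a countable family of open sets, so Baire's theorem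
and homogeneity make the closure of every local orbit a neighborhood of its base point. A second
back-and-forth argument, `MovesWithin.of_mem_closure`, removes the closure.

For finite sets, points are moved one at a time, which needs complements of finite sets to be
connected. If `Y` has an isolated point, the ray over it is an open line and X is a 1-manifold.
Otherwise a point at level 1 of a chart has small neighborhoods that are products of two connected
nondegenerate sets, which a point cannot separate (`IsLocallyConical.locallyNonseparating`). Empty
`Y` makes points open. -/

/-! ### Completeness and limits of homeomorphisms -/

/-- A locally compact separable metric space is Polish, being open in its completion. -/
theorem polishSpace_of_locallyCompact (X : Type*) [MetricSpace X]
    [TopologicalSpace.SeparableSpace X] [LocallyCompactSpace X] : PolishSpace X := by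
  let i : X → UniformSpace.Completion X := fun x => x
  have hi : IsDenseEmbedding i := UniformSpace.Completion.isDenseEmbedding_coe
  have hopen : IsOpen (range i) := by
    rw [isOpen_iff_mem_nhds]
    rintro _ ⟨x, rfl⟩
    obtain ⟨K, hK, hxK⟩ := exists_compact_mem_nhds x
    rw [hi.isInducing.nhds_eq_comap] at hxK
    obtain ⟨V, hV, hVK⟩ := hxK
    refine mem_of_superset (interior_mem_nhds.2 hV) ?_
    have h1 : interior V ⊆ closure (interior V ∩ range i) :=
      hi.dense.open_subset_closure_inter isOpen_interior
    have h2 : interior V ∩ range i ⊆ i '' K := by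
      rintro _ ⟨hv, y, rfl⟩
      exact ⟨y, hVK (show i y ∈ V from interior_subset hv), rfl⟩
    have h3 : IsClosed (i '' K) := (hK.image hi.continuous).isClosed
    exact (h1.trans (closure_minimal h2 h3)).trans (image_subset_range _ _)
  have : TopologicalSpace.SeparableSpace (UniformSpace.Completion X) := by
    infer_instance
  have : PolishSpace (UniformSpace.Completion X) := inferInstance
  have : PolishSpace (range i) := hopen.polishSpace
  exact (hi.isEmbedding.toHomeomorph).isClosedEmbedding.polishSpace

/-- A sequence of homeomorphisms that is uniformly Cauchy together with the inverses converges
pointwise to a homeomorphism. -/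
theorem Homeomorph.exists_tendsto_of_cauchy {X : Type*} [MetricSpace X] [CompleteSpace X]
    (F : ℕ → X ≃ₜ X)
    (hF : ∀ ε > 0, ∃ N, ∀ n ≥ N, ∀ x, dist (F n x) (F N x) < ε)
    (hF' : ∀ ε > 0, ∃ N, ∀ n ≥ N, ∀ x, dist ((F n).symm x) ((F N).symm x) < ε) :
    ∃ G : X ≃ₜ X, ∀ x, Tendsto (fun n => F n x) atTop (𝓝 (G x)) := by
  have key : ∀ f : ℕ → X → X, (∀ n, Continuous (f n)) →
      (∀ ε > 0, ∃ N, ∀ n ≥ N, ∀ x, dist (f n x) (f N x) < ε) →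
      ∃ g : X → X, Continuous g ∧ TendstoUniformly f g atTop := by
    intro f hc hf
    have hcau : UniformCauchySeqOn f atTop univ := by
      rw [Metric.uniformCauchySeqOn_iff]
      intro ε hε
      obtain ⟨N, hN⟩ := hf (ε / 2) (half_pos hε)
      refine ⟨N, fun m hm n hn x _ => ?_⟩
      calc dist (f m x) (f n x) ≤ dist (f m x) (f N x) + dist (f n x) (f N x) :=
            dist_triangle_right _ _ _
        _ < ε / 2 + ε / 2 := add_lt_add (hN m hm x) (hN n hn x)
        _ = ε := add_halves ε
    have hpt : ∀ x, ∃ y, Tendsto (fun n => f n x) atTop (𝓝 y) := fun x =>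
      cauchySeq_tendsto_of_complete (hcau.cauchySeq (mem_univ x))
    choose g hg using hpt
    have hu : TendstoUniformly f g atTop := by
      rw [← tendstoUniformlyOn_univ]
      exact hcau.tendstoUniformlyOn_of_tendsto fun x _ => hg x
    exact ⟨g, hu.continuous (Frequently.of_forall hc), hu⟩
  obtain ⟨g, hgc, hg⟩ := key (fun n => F n) (fun n => (F n).continuous) hF
  obtain ⟨k, hkc, hk⟩ := key (fun n => (F n).symm) (fun n => (F n).symm.continuous) hF'
  refine ⟨⟨⟨g, k, fun x => ?_, fun x => ?_⟩, hgc, hkc⟩, fun x => hg.tendsto_at x⟩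
  -- Uniform convergence allows the argument to move with n, so the identities between `F n` and its
  -- inverse pass to the limit.
  · refine tendsto_nhds_unique (hk.tendsto_comp hkc.continuousAt (hg.tendsto_at x)) ?_
    simp
  · refine tendsto_nhds_unique (hg.tendsto_comp hgc.continuousAt (hk.tendsto_at x)) ?_
    simp

theorem Homeomorph.exists_tendsto_of_summable {X : Type*} [MetricSpace X] [CompleteSpace X]
    (F : ℕ → X ≃ₜ X)
    (hF : ∀ n x, dist (F (n + 1) x) (F n x) ≤ (1 / 2) ^ n)
    (hF' : ∀ n x, dist ((F (n + 1)).symm x) ((F n).symm x) ≤ (1 / 2) ^ n) :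
    ∃ G : X ≃ₜ X, ∀ x, Tendsto (fun n => F n x) atTop (𝓝 (G x)) := by
  have key : ∀ f : ℕ → X → X, (∀ n x, dist (f (n + 1) x) (f n x) ≤ (1 / 2) ^ n) →
      ∀ ε > 0, ∃ N, ∀ n ≥ N, ∀ x, dist (f n x) (f N x) < ε := by
    intro f hf ε hε
    obtain ⟨N, hN⟩ := exists_pow_lt_of_lt_one (half_pos hε) (show (1 / 2 : ℝ) < 1 by norm_num)
    -- The subtracted tail of the geometric series is what makes the induction on k close.
    have hb : ∀ k x, dist (f (N + k) x) (f N x) ≤ 2 * (1 / 2) ^ N - 2 * (1 / 2) ^ (N + k) := by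
      intro k x
      induction k with
      | zero => simp
      | succ k ih =>
        have := hf (N + k) x
        have h3 := dist_triangle (f (N + (k + 1)) x) (f (N + k) x) (f N x)
        have h4 : (2 : ℝ) * (1 / 2) ^ (N + (k + 1)) = (1 / 2) ^ (N + k) := by
          rw [← add_assoc, pow_succ]; ring
        rw [← add_assoc] at h3 h4 ⊢
        linarith
    refine ⟨N, fun n hn x => ?_⟩
    obtain ⟨k, rfl⟩ := Nat.exists_eq_add_of_le hn
    have := hb k x
    have h5 : (0 : ℝ) < (1 / 2) ^ (N + k) := by positivity
    linarith
  exact Homeomorph.exists_tendsto_of_cauchy F (key _ hF) (key _ hF')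

/-! ### Local orbits -/

/-- Some homeomorphism that is the identity outside `U` maps `x` to `y`. -/
def MovesWithin {X : Type*} [TopologicalSpace X] (U : Set X) (x y : X) : Prop :=
  ∃ h : X ≃ₜ X, h x = y ∧ ∀ z ∉ U, h z = z

/-- Every point can be moved to all nearby points by homeomorphisms with support in a given
neighborhood. -/
def IsStronglyLocallyHomogeneous (X : Type*) [TopologicalSpace X] : Prop :=
  ∀ (U : Set X) (x : X), IsOpen U → x ∈ U → {y | MovesWithin U x y} ∈ 𝓝 x

namespace MovesWithin

variable {X : Type*} [TopologicalSpace X] {U V : Set X} {x y z : X}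

theorem mem_iff_of_fixed {h : X ≃ₜ X} (hU : ∀ z ∉ U, h z = z) : h x ∈ U ↔ x ∈ U := by
  constructor
  · intro hx
    by_contra hn
    exact hn (hU x hn ▸ hx)
  · intro hx
    by_contra hn
    have := h.injective (hU _ hn)
    exact hn (this.symm ▸ hx)

theorem symm_fixed {h : X ≃ₜ X} (hU : ∀ z ∉ U, h z = z) : ∀ z ∉ U, h.symm z = z :=
  fun z hz => by rw [Homeomorph.symm_apply_eq, hU z hz]

theorem refl (U : Set X) (x : X) : MovesWithin U x x := ⟨Homeomorph.refl X, rfl, fun _ _ => rfl⟩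

theorem symm (h : MovesWithin U x y) : MovesWithin U y x := by
  obtain ⟨h, rfl, hU⟩ := h
  exact ⟨h.symm, h.symm_apply_apply x, symm_fixed hU⟩

theorem trans (h : MovesWithin U x y) (h' : MovesWithin U y z) : MovesWithin U x z := by
  obtain ⟨h, rfl, hU⟩ := h
  obtain ⟨k, rfl, kU⟩ := h'
  exact ⟨h.trans k, rfl, fun z hz => by simp [hU z hz, kU z hz]⟩

theorem mono (h : MovesWithin U x y) (hUV : U ⊆ V) : MovesWithin V x y := by
  obtain ⟨h, rfl, hU⟩ := h
  exact ⟨h, rfl, fun z hz => hU z fun hz' => hz (hUV hz')⟩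

theorem mem (h : MovesWithin U x y) (hx : x ∈ U) : y ∈ U := by
  obtain ⟨h, rfl, hU⟩ := h
  exact (mem_iff_of_fixed hU).2 hx

theorem conj (k : X ≃ₜ X) (h : MovesWithin (k ⁻¹' U) x y) : MovesWithin U (k x) (k y) := by
  obtain ⟨h, rfl, hU⟩ := h
  refine ⟨(k.symm.trans h).trans k, by simp, fun z hz => ?_⟩
  have : k.symm z ∉ k ⁻¹' U := by simpa using hz
  simp [hU _ this]

/-- In a strongly locally homogeneous space, connected open sets are orbits. -/
theorem of_isPreconnected (hs : IsStronglyLocallyHomogeneous X) (hU : IsOpen U)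
    (hc : IsPreconnected U) (hx : x ∈ U) (hy : y ∈ U) : MovesWithin U x y := by
  by_contra hxy
  -- Orbits are open, so every union of orbits in `U` is open. This is applied to the orbit of x and
  -- to its complement.
  have hopen : ∀ P : X → Prop, (∀ a b, MovesWithin U a b → P a → P b) →
      IsOpen {a | a ∈ U ∧ P a} := by
    intro P hP
    rw [isOpen_iff_mem_nhds]
    rintro a ⟨haU, ha⟩
    filter_upwards [hs U a hU haU] with b hb
    exact ⟨hb.mem haU, hP a b hb ha⟩
  obtain ⟨w, -, ⟨-, h1⟩, -, h2⟩ := hc _ _ (hopen (fun a => MovesWithin U x a) fun a b hab ha => ha.trans hab)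
    (hopen (fun a => ¬ MovesWithin U x a) fun a b hab ha hb => ha (hb.trans hab.symm))
    (fun a ha => (em (MovesWithin U x a)).imp (fun h => ⟨ha, h⟩) fun h => ⟨ha, h⟩)
    ⟨x, hx, hx, refl U x⟩ ⟨y, hy, hy, hxy⟩
  exact h2 h1

end MovesWithin

/-! ### Back-and-forth constructions -/

theorem exists_seq_of_forall_step {σ : Type*} (Q : ℕ → σ → Prop) (R : ℕ → σ → σ → Prop)
    (h0 : ∃ s, Q 0 s) (h : ∀ n s, Q n s → ∃ s', Q (n + 1) s' ∧ R n s s') :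
    ∃ f : ℕ → σ, ∀ n, Q n (f n) ∧ R n (f n) (f (n + 1)) := by
  obtain ⟨s0, hs0⟩ := h0
  choose! g hg using h
  let f : ℕ → σ := fun n => Nat.rec s0 g n
  have hf : ∀ n, Q n (f n) := by
    intro n
    induction n with
    | zero => exact hs0
    | succ n ih => exact (hg n _ ih).1
  exact ⟨f, fun n => ⟨hf n, (hg n _ (hf n)).2⟩⟩

section Metric

variable {X : Type*} [MetricSpace X]

/-- Following `F` by a map supported in `U` changes `F` by at most the diameter of `U`, but changes
the inverse by at most that of its pullback under `F`. Both must be small for limits to be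
homeomorphisms. -/
theorem Homeomorph.exists_small_nhd (F : X ≃ₜ X) {W : Set X} {x : X} (hW : W ∈ 𝓝 x) {ε : ℝ}
    (hε : 0 < ε) : ∃ U ⊆ W, IsOpen U ∧ x ∈ U ∧
      ∀ u ∈ U, ∀ v ∈ U, dist u v ≤ ε ∧ dist (F.symm u) (F.symm v) ≤ ε := by
  have h1 : Metric.ball x (ε / 2) ∈ 𝓝 x := Metric.ball_mem_nhds _ (half_pos hε)
  have h2 : F.symm ⁻¹' Metric.ball (F.symm x) (ε / 2) ∈ 𝓝 x :=
    F.symm.continuous.continuousAt (Metric.ball_mem_nhds _ (half_pos hε))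
  refine ⟨interior (W ∩ (Metric.ball x (ε / 2) ∩ F.symm ⁻¹' Metric.ball (F.symm x) (ε / 2))),
    interior_subset.trans inter_subset_left, isOpen_interior,
    mem_interior_iff_mem_nhds.2 (inter_mem hW (inter_mem h1 h2)), fun u hu v hv => ?_⟩
  obtain ⟨-, hu1, hu2⟩ := interior_subset hu
  obtain ⟨-, hv1, hv2⟩ := interior_subset hv
  simp only [Metric.mem_ball, mem_preimage] at hu1 hu2 hv1 hv2
  constructor
  · linarith [dist_triangle_right u v x]
  · linarith [dist_triangle_right (F.symm u) (F.symm v) (F.symm x)]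

theorem Homeomorph.dist_trans_le_of_small_support (F h : X ≃ₜ X) {U : Set X} {ε : ℝ}
    (hε : 0 ≤ ε) (hU : ∀ u ∈ U, ∀ v ∈ U, dist u v ≤ ε ∧ dist (F.symm u) (F.symm v) ≤ ε)
    (hh : ∀ z ∉ U, h z = z) (x : X) :
    dist (F.trans h x) (F x) ≤ ε ∧ dist ((F.trans h).symm x) (F.symm x) ≤ ε := by
  constructor
  · by_cases hx : F x ∈ U
    · exact (hU _ ((MovesWithin.mem_iff_of_fixed hh).2 hx) _ hx).1
    · simpa [hh _ hx] using hε
  · have hh' := MovesWithin.symm_fixed hh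
    by_cases hx : x ∈ U
    · exact (hU _ ((MovesWithin.mem_iff_of_fixed hh').2 hx) _ hx).2
    · simpa [hh' _ hx] using hε

/-- One half of a back-and-forth step: push `F a` into the dense set by a map whose small support
avoids the finite set `F '' S` of values already settled. -/
theorem IsStronglyLocallyHomogeneous.exists_perturbation (hs : IsStronglyLocallyHomogeneous X)
    (F : X ≃ₜ X) {S : Set X} (hS : S.Finite) {B : Set X} (hB : Dense B) (hSB : ∀ s ∈ S, F s ∈ B)
    (a : X) {ε : ℝ} (hε : 0 < ε) :
    ∃ F' : X ≃ₜ X, (∀ s ∈ S, F' s = F s) ∧ F' a ∈ B ∧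
      ∀ x, dist (F' x) (F x) ≤ ε ∧ dist (F'.symm x) (F.symm x) ≤ ε := by
  by_cases ha : a ∈ S
  · exact ⟨F, fun _ _ => rfl, hSB a ha, fun x => by simp [hε.le]⟩
  have hW : (F '' S)ᶜ ∈ 𝓝 (F a) := by
    refine (hS.image F).isClosed.isOpen_compl.mem_nhds ?_
    rintro ⟨s, hs, h⟩
    exact ha (F.injective h ▸ hs)
  obtain ⟨U, hUW, hUo, hxU, hU⟩ := F.exists_small_nhd hW hε
  obtain ⟨b, hb, h, hab, hh⟩ := hB.inter_nhds_nonempty (hs U (F a) hUo hxU)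
  refine ⟨F.trans h, fun s hs => ?_, ?_, F.dist_trans_le_of_small_support h hε.le hU hh⟩
  · exact hh _ fun hn => hUW hn ⟨s, hs, rfl⟩
  · simpa [hab] using hb

theorem IsStronglyLocallyHomogeneous.isCountableDenseHomogeneous {X : Type u} [MetricSpace X]
    [CompleteSpace X] (hs : IsStronglyLocallyHomogeneous X) : IsCountableDenseHomogeneous X := by
  intro A B hAc hA hBc hB
  rcases isEmpty_or_nonempty X with hX | hX
  · exact ⟨Homeomorph.refl X, by simp [Set.eq_empty_of_isEmpty]⟩
  obtain ⟨a, rfl⟩ := hAc.exists_eq_range hA.nonempty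
  obtain ⟨b, rfl⟩ := hBc.exists_eq_range hB.nonempty
  -- A state is a homeomorphism together with the finite set of points of `A` on which it is frozen.
  obtain ⟨f, hf⟩ := exists_seq_of_forall_step
    (fun n (s : (X ≃ₜ X) × Set X) => s.2.Finite ∧ s.2 ⊆ range a ∧ ∀ x ∈ s.2, s.1 x ∈ range b)
    (fun n s s' => s.2 ⊆ s'.2 ∧ (∀ x ∈ s.2, s'.1 x = s.1 x) ∧ a n ∈ s'.2 ∧
      (s'.1.symm (b n) ∈ s'.2) ∧ (∀ x, dist (s'.1 x) (s.1 x) ≤ (1 / 2) ^ n ∧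
        dist (s'.1.symm x) (s.1.symm x) ≤ (1 / 2) ^ n))
    ⟨⟨Homeomorph.refl X, ∅⟩, by simp⟩ (by
      rintro n ⟨F, S⟩ ⟨hS, hSa, hSb⟩
      simp only at hS hSa hSb
      -- One half is spent on placing `a n`, the other on hitting `b n`.
      have hε : (0 : ℝ) < (1 / 2) ^ n / 2 := by positivity
      obtain ⟨F', h1, h2, h3⟩ := hs.exists_perturbation F hS hB hSb (a n) hε
      have hS' : ∀ x ∈ insert (a n) S, F' x ∈ range b := by
        rintro x (rfl | hx)
        · exact h2
        · exact h1 x hx ▸ hSb x hx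
      have hSa' : insert (a n) S ⊆ range a := insert_subset (mem_range_self n) hSa
      -- The back step is the forth step for the inverse, with the roles of the two dense sets
      -- exchanged.
      obtain ⟨G, g1, g2, g3⟩ := hs.exists_perturbation F'.symm
        ((hS.insert (a n)).image F') hA (by
          rintro _ ⟨x, hx, rfl⟩
          simpa using hSa' hx) (b n) hε
      have hG : ∀ x ∈ insert (a n) S, G.symm x = F' x := fun x hx => by
        rw [Homeomorph.symm_apply_eq, g1 _ (mem_image_of_mem _ hx), F'.symm_apply_apply]
      refine ⟨⟨G.symm, insert (G (b n)) (insert (a n) S)⟩,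
        ⟨(hS.insert _).insert _, insert_subset g2 hSa', ?_⟩,
        (subset_insert _ _).trans (subset_insert _ _), ?_, by simp, by simp, fun x => ?_⟩
      · rintro x (rfl | hx)
        · simp
        · simpa only [hG x hx] using hS' x hx
      · intro x hx
        simp only
        rw [hG x (mem_insert_of_mem _ hx), h1 x hx]
      · have e1 := h3 x
        have e2 := g3 x
        have e3 := dist_triangle (G.symm x) (F' x) (F x)
        have e4 := dist_triangle (G x) (F'.symm x) (F.symm x)
        simp only [Homeomorph.symm_symm] at e2 ⊢
        constructor <;> linarith [e1.1, e1.2, e2.1, e2.2])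
  obtain ⟨G, hG⟩ := Homeomorph.exists_tendsto_of_summable (fun n => (f n).1)
    (fun n x => ((hf n).2.2.2.2.2 x).1) (fun n x => ((hf n).2.2.2.2.2 x).2)
  have hfix : ∀ n, ∀ x ∈ (f n).2, G x = (f n).1 x := by
    intro n x hx
    have hk : ∀ k, x ∈ (f (n + k)).2 ∧ (f (n + k)).1 x = (f n).1 x := by
      intro k
      induction k with
      | zero => exact ⟨hx, rfl⟩
      | succ k ih => exact ⟨(hf (n + k)).2.1 ih.1, ((hf (n + k)).2.2.1 x ih.1).trans ih.2⟩
    refine tendsto_nhds_unique (hG x) (tendsto_const_nhds.congr' ?_)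
    filter_upwards [eventually_ge_atTop n] with m hm
    obtain ⟨k, rfl⟩ := Nat.exists_eq_add_of_le hm
    exact (hk k).2.symm
  refine ⟨G, Subset.antisymm ?_ ?_⟩
  · rintro _ ⟨_, ⟨n, rfl⟩, rfl⟩
    have hn := (hf n).2.2.2.1
    rw [hfix (n + 1) _ hn]
    exact (hf (n + 1)).1.2.2 _ hn
  · rintro _ ⟨n, rfl⟩
    have hn := (hf n).2.2.2.2.1
    exact ⟨_, (hf (n + 1)).1.2.1 hn, by rw [hfix (n + 1) _ hn, Homeomorph.apply_symm_apply]⟩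

variable [CompleteSpace X]

/-- If the closures of all local orbits are neighborhoods, then local orbits are relatively
closed: `x` and `y` are moved to a common point by two convergent sequences of homeomorphisms. -/
theorem MovesWithin.of_mem_closure
    (hcl : ∀ (U : Set X) (x : X), IsOpen U → x ∈ U →
      x ∈ interior (closure {y | MovesWithin U x y}))
    {U : Set X} (hU : IsOpen U) {x y : X} (hx : x ∈ U) (hy : y ∈ U)
    (hxy : y ∈ closure {y | MovesWithin U x y}) : MovesWithin U x y := by
  -- A state holds maps H, K and an open set containing both H x and K y. Alternately H x is moved
  -- close to K y and K y close to H x, in shrinking open sets, so that the limits agree: H x = K y.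
  let σ := (X ≃ₜ X) × (X ≃ₜ X) × Set X
  let W : σ → Prop := fun s => IsOpen s.2.2 ∧ s.2.2 ⊆ U ∧ (∀ z ∉ U, s.1 z = z) ∧
    (∀ z ∉ U, s.2.1 z = z) ∧ s.1 x ∈ s.2.2 ∧ s.2.1 y ∈ s.2.2 ∧
    s.2.1 y ∈ closure {w | MovesWithin s.2.2 (s.1 x) w}
  let D : ℝ → σ → Prop := fun ε s => ∀ u ∈ s.2.2, ∀ v ∈ s.2.2,
    dist u v ≤ ε ∧ dist (s.1.symm u) (s.1.symm v) ≤ ε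
  have step : ∀ s, W s → ∀ ε > 0, ∃ s', W s' ∧ D ε s' ∧
      (∃ h : X ≃ₜ X, (∀ z ∉ s.2.2, h z = z) ∧ s'.1 = s.1.trans h) ∧
      ∀ z, dist (s'.2.1 z) (s.2.1 z) ≤ ε ∧ dist (s'.2.1.symm z) (s.2.1.symm z) ≤ ε := by
    rintro ⟨H, K, V⟩ ⟨hV, hVU, hH, hK, hHV, hKV, hc⟩ ε hε
    simp only at hV hVU hH hK hHV hKV hc
    obtain ⟨V', hV'V, hV', hKV', hsmall⟩ := K.exists_small_nhd (hV.mem_nhds hKV) hε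
    obtain ⟨_, ⟨hha1, hha2⟩, h, rfl, hh⟩ := mem_closure_iff.1 hc
      (V' ∩ interior (closure {w | MovesWithin V' (K y) w})) (hV'.inter isOpen_interior)
      ⟨hKV', hcl V' _ hV' hKV'⟩
    obtain ⟨V'', hV''V', hV'', hHV'', hsmall''⟩ :=
      (H.trans h).exists_small_nhd (hV'.mem_nhds hha1) hε
    obtain ⟨_, ⟨hb1, hb2⟩, k, rfl, hk⟩ := mem_closure_iff.1 (interior_subset hha2)
      (V'' ∩ interior (closure {w | MovesWithin V'' (h (H x)) w})) (hV''.inter isOpen_interior)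
      ⟨hHV'', hcl V'' _ hV'' hHV''⟩
    refine ⟨⟨H.trans h, K.trans k, V''⟩, ⟨hV'', hV''V'.trans (hV'V.trans hVU), ?_, ?_, hHV'', hb1,
      interior_subset hb2⟩, hsmall'', ⟨h, hh, rfl⟩,
      K.dist_trans_le_of_small_support k hε.le hsmall hk⟩
    · intro z hz
      simp [hH z hz, hh z fun hz' => hz (hVU hz')]
    · intro z hz
      simp [hK z hz, hk z fun hz' => hz (hVU (hV'V hz'))]
  -- The first step is made only to obtain a state satisfying `D` at scale 1.
  obtain ⟨s0, hW0, hD0, -, -⟩ := step ⟨Homeomorph.refl X, Homeomorph.refl X, U⟩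
    ⟨hU, Subset.rfl, fun _ _ => rfl, fun _ _ => rfl, hx, hy, hxy⟩ 1 one_pos
  obtain ⟨f, hf⟩ := exists_seq_of_forall_step (fun n s => W s ∧ D ((1 / 2) ^ n) s)
    (fun n s s' => ∀ z, (dist (s'.1 z) (s.1 z) ≤ (1 / 2) ^ n ∧
        dist (s'.1.symm z) (s.1.symm z) ≤ (1 / 2) ^ n) ∧
      (dist (s'.2.1 z) (s.2.1 z) ≤ (1 / 2) ^ n ∧
        dist (s'.2.1.symm z) (s.2.1.symm z) ≤ (1 / 2) ^ n)) ⟨s0, hW0, by simpa using hD0⟩ (by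
    rintro n s ⟨hW, hD⟩
    obtain ⟨s', hW', hD', ⟨h, hh, hs'⟩, hd⟩ := step s hW ((1 / 2) ^ (n + 1)) (by positivity)
    refine ⟨s', ⟨hW', hD'⟩, fun z => ⟨?_, ?_⟩⟩
    -- The map h is supported in the old open set, so its size is controlled by the previous `D`;
    -- this is why `D` belongs to the invariant.
    · rw [hs']
      exact s.1.dist_trans_le_of_small_support h (by positivity) hD hh z
    · have hle : ((1 : ℝ) / 2) ^ (n + 1) ≤ (1 / 2) ^ n :=
        pow_le_pow_of_le_one (by norm_num) (by norm_num) n.le_succ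
      exact ⟨(hd z).1.trans hle, (hd z).2.trans hle⟩)
  obtain ⟨H, hH⟩ := Homeomorph.exists_tendsto_of_summable (fun n => (f n).1)
    (fun n z => ((hf n).2 z).1.1) (fun n z => ((hf n).2 z).1.2)
  obtain ⟨K, hK⟩ := Homeomorph.exists_tendsto_of_summable (fun n => (f n).2.1)
    (fun n z => ((hf n).2 z).2.1) (fun n z => ((hf n).2 z).2.2)
  have hHU : ∀ z ∉ U, H z = z := fun z hz =>
    tendsto_nhds_unique (hH z)
      (tendsto_const_nhds.congr fun n => ((hf n).1.1.2.2.1 z hz).symm)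
  have hKU : ∀ z ∉ U, K z = z := fun z hz =>
    tendsto_nhds_unique (hK z)
      (tendsto_const_nhds.congr fun n => ((hf n).1.1.2.2.2.1 z hz).symm)
  have hHK : H x = K y := by
    refine eq_of_dist_eq_zero (tendsto_nhds_unique ((hH x).dist (hK y)) ?_)
    refine squeeze_zero (fun _ => dist_nonneg) (fun n => ?_)
      (tendsto_pow_atTop_nhds_zero_of_lt_one (r := (1 / 2 : ℝ)) (by norm_num) (by norm_num))
    obtain ⟨hW, hD⟩ := (hf n).1
    exact (hD _ hW.2.2.2.2.1 _ hW.2.2.2.2.2.1).1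
  exact MovesWithin.trans ⟨H, rfl, hHU⟩ (MovesWithin.symm ⟨K, hHK.symm, hKU⟩)

theorem isStronglyLocallyHomogeneous_of_mem_interior_closure
    (hcl : ∀ (U : Set X) (x : X), IsOpen U → x ∈ U →
      x ∈ interior (closure {y | MovesWithin U x y})) : IsStronglyLocallyHomogeneous X := by
  intro U x hU hx
  filter_upwards [hU.mem_nhds hx, mem_interior_iff_mem_nhds.1 (hcl U x hU hx)] with y hy hxy
  exact MovesWithin.of_mem_closure hcl hU hx hy hxy

end Metric

/-! ### Radial structures -/

/-- If `f` vanishes only at `p` and has a compact sublevel set, then its sublevel sets shrink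
to `p`. -/
theorem exists_forall_le_imp_mem_of_isCompact {X : Type*} [TopologicalSpace X] {f : X → ℝ≥0∞}
    (hf : Continuous f) {p : X} (hp : ∀ x, f x = 0 → x = p)
    (hc : IsCompact {x | f x ≤ (1 : ℝ≥0)}) {W : Set X} (hW : W ∈ 𝓝 p) :
    ∃ ε : ℝ≥0∞, 0 < ε ∧ ∀ x, f x ≤ ε → x ∈ W := by
  have hK : IsCompact ({x | f x ≤ (1 : ℝ≥0)} \ interior W) :=
    hc.diff isOpen_interior
  have hlt : ∃ ε : ℝ≥0∞, 0 < ε ∧ ε ≤ 1 ∧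
      ∀ x ∈ ({x | f x ≤ (1 : ℝ≥0)} \ interior W), ε < f x := by
    rcases ({x | f x ≤ (1 : ℝ≥0)} \ interior W).eq_empty_or_nonempty with he | hne
    · exact ⟨1, one_pos, le_rfl, fun x hx => absurd hx (by simp only [he, mem_empty_iff_false, not_false_eq_true])⟩
    · obtain ⟨m, ⟨hm1, hm2⟩, hmin⟩ := hK.exists_isMinOn hne hf.continuousOn
      have hpos : 0 < f m := by
        refine pos_iff_ne_zero.2 fun h => hm2 ?_
        rw [hp m h]
        exact mem_interior_iff_mem_nhds.2 hW
      obtain ⟨ε, h0, h1⟩ := exists_between hpos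
      exact ⟨ε, h0, (h1.le.trans (by simpa using hm1)), fun x hx => h1.trans_le (hmin hx)⟩
  obtain ⟨ε, h0, h1, h2⟩ := hlt
  refine ⟨ε, h0, fun x hx => ?_⟩
  by_contra hxW
  exact (h2 x ⟨by simpa using hx.trans h1, fun h => hxW (interior_subset h)⟩).not_ge hx

/-- A radius function around `p` with compact sublevel sets, together with homeomorphisms
contracting these sublevel sets towards `p`. -/
structure RadialStructure {X : Type*} [TopologicalSpace X] (p : X) where
  rad : X → ℝ≥0∞
  continuous_rad : Continuous rad
  rad_eq_zero_iff : ∀ x, rad x = 0 ↔ x = p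
  isCompact_rad_le : ∀ r : ℝ≥0, IsCompact {x | rad x ≤ r}
  shrink : ℝ≥0 → X ≃ₜ X
  rad_shrink_le : ∀ (k : ℝ≥0) (x : X), rad x ≤ k → rad (shrink k x) ≤ rad x * 8⁻¹
  shrink_of_le : ∀ (k : ℝ≥0) (x : X), 2 * (k : ℝ≥0∞) ≤ rad x → shrink k x = x
  shrink_congr : ∀ (k k' : ℝ≥0) (x : X), rad x ≤ k → rad x ≤ k' → shrink k x = shrink k' x

namespace RadialStructure

variable {X : Type*} [TopologicalSpace X] {p : X} (R : RadialStructure p)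

theorem rad_self : R.rad p = 0 := (R.rad_eq_zero_iff p).2 rfl

theorem exists_rad_le_subset {W : Set X} (hW : W ∈ 𝓝 p) :
    ∃ ε : ℝ≥0∞, 0 < ε ∧ ∀ x, R.rad x ≤ ε → x ∈ W :=
  exists_forall_le_imp_mem_of_isCompact R.continuous_rad (fun x => (R.rad_eq_zero_iff x).1)
    (R.isCompact_rad_le 1) hW

theorem shrink_mapsTo (k : ℝ≥0) (x : X) (hx : R.rad x ≤ k) : R.rad (R.shrink k x) ≤ k :=
  (R.rad_shrink_le k x hx).trans ((mul_le_of_le_one_right' (by simp)).trans hx)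

theorem rad_shrink_pow_le (k : ℝ≥0) (n : ℕ) (x : X) (hx : R.rad x ≤ k) :
    R.rad ((R.shrink k ^ n) x) ≤ k ∧ R.rad ((R.shrink k ^ n) x) ≤ k * 8⁻¹ ^ n := by
  induction n with
  | zero => simpa using hx
  | succ n ih =>
    rw [pow_succ']
    change R.rad (R.shrink k ((R.shrink k ^ n) x)) ≤ k ∧ R.rad (R.shrink k ((R.shrink k ^ n) x)) ≤ _
    refine ⟨R.shrink_mapsTo k _ ih.1, (R.rad_shrink_le k _ ih.1).trans ?_⟩
    rw [pow_succ, ← mul_assoc]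
    gcongr
    exact ih.2

theorem shrink_self (k : ℝ≥0) : R.shrink k p = p := by
  rw [← R.rad_eq_zero_iff, ← nonpos_iff_eq_zero]
  simpa [R.rad_self] using R.rad_shrink_le k p (by simp [R.rad_self])

theorem eventually_shrink_pow_mem (k : ℝ≥0) {W : Set X} (hW : W ∈ 𝓝 p) :
    ∀ᶠ n in atTop, ∀ x, R.rad x ≤ k → (R.shrink k ^ n) x ∈ W := by
  obtain ⟨ε, h0, hε⟩ := R.exists_rad_le_subset hW
  have ht : Tendsto (fun n : ℕ => (k : ℝ≥0∞) * (8⁻¹ : ℝ≥0∞) ^ n) atTop (𝓝 0) := by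
    have := ENNReal.Tendsto.const_mul (a := (k : ℝ≥0∞))
      (ENNReal.tendsto_pow_atTop_nhds_zero_of_lt_one (r := (8⁻¹ : ℝ≥0∞)) (by simp))
      (Or.inr ENNReal.coe_ne_top)
    simpa using this
  filter_upwards [ht.eventually (gt_mem_nhds h0)] with n hn x hx
  refine hε _ ((R.rad_shrink_pow_le k n x hx).2.trans hn.le)

end RadialStructure

/-! ### The infinite swindle -/

section Swindle

variable {X : Type*} [MetricSpace X] [CompleteSpace X]

/-- An infinite swindle: if `φ` and `ψ` contract a set `P` to `p` and `q`, and `g` is supported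
in `U ⊆ P` and agrees with `ψ ∘ φ⁻¹` on `φ '' P`, then the infinite product of the conjugates
`φ ^ n * g * φ ^ (-n)` maps `p` to `q`. -/
theorem MovesWithin.of_swindle (φ ψ g : X ≃ₜ X) (P U : Set X) (hUP : U ⊆ P) {p q : X}
    (hpP : p ∈ P) (hφp : φ p = p)
    (hφ : ∀ W ∈ 𝓝 p, ∀ᶠ n in atTop, ∀ x ∈ P, (φ ^ n) x ∈ W)
    (hψ : ∀ W ∈ 𝓝 q, ∀ᶠ n in atTop, ∀ x ∈ P, (ψ ^ n) x ∈ W)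
    (hgU : ∀ z ∉ U, g z = z) (hg : ∀ z ∈ P, g (φ z) = ψ z)
    (hPU : ∀ z ∈ P, φ z ∈ U) : MovesWithin U p q := by
  -- This is the partial product of the conjugates of g by 1, φ, ..., φ ^ (n - 1), rewritten so that
  -- its value at (φ ^ n) z is (ψ ^ n) z for z in `P`.
  let F : ℕ → X ≃ₜ X := fun n => (g * φ) ^ n * (φ ^ n)⁻¹
  have hFφ : ∀ n z, F n ((φ ^ n) z) = ((g * φ) ^ n) z := fun n z => by
    change ((g * φ) ^ n * (φ ^ n)⁻¹ * φ ^ n) z = _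
    rw [inv_mul_cancel_right]
  have hgP : ∀ z ∈ P, (g * φ) z = ψ z := hg
  have hgφP : ∀ z ∈ P, ψ z ∈ P := fun z hz => by
    rw [← hg z hz]
    exact hUP ((mem_iff_of_fixed hgU).2 (hPU z hz))
  have hpow : ∀ n, ∀ z ∈ P, ((g * φ) ^ n) z = (ψ ^ n) z ∧ (ψ ^ n) z ∈ P := by
    intro n z hz
    induction n with
    | zero => exact ⟨rfl, hz⟩
    | succ n ih =>
      rw [pow_succ', pow_succ']
      change (g * φ) (((g * φ) ^ n) z) = ψ ((ψ ^ n) z) ∧ ψ ((ψ ^ n) z) ∈ P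
      rw [ih.1, hgP _ ih.2]
      exact ⟨rfl, hgφP _ ih.2⟩
  have hFadd : ∀ n k w, F (n + k) ((φ ^ n) w) = ((g * φ) ^ n) (F k w) := by
    intro n k w
    have : (g * φ) ^ (n + k) * (φ ^ (n + k))⁻¹ * φ ^ n = (g * φ) ^ n * ((g * φ) ^ k * (φ ^ k)⁻¹) := by
      rw [pow_add, pow_add, mul_inv_rev, mul_assoc, inv_mul_cancel_right, mul_assoc]
    exact DFunLike.congr_fun this w
  have hφU : ∀ n, ∀ z ∈ U, (φ ^ n) z ∈ U := by
    intro n z hz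
    induction n with
    | zero => exact hz
    | succ n ih =>
      rw [pow_succ']
      exact hPU _ (hUP ih)
  have hFU : ∀ n, ∀ z ∉ U, F n z = z := by
    intro n z hz
    induction n with
    | zero => rfl
    | succ n ih =>
      obtain ⟨w, rfl⟩ := (φ ^ n).surjective z
      have hw : w ∉ U := fun h => hz (hφU n w h)
      rw [hFφ] at ih
      have h1 : F 1 w = g w := by
        change ((g * φ) ^ 1 * (φ ^ 1)⁻¹) w = g w
        rw [pow_one, pow_one, mul_inv_cancel_right]
      rw [hFadd, h1, hgU w hw, ih]
  have hFP : ∀ n, ∀ z ∈ P, F n z ∈ P := fun n z hz => by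
    by_cases h : z ∈ U
    · exact hUP ((mem_iff_of_fixed (hFU n)).2 h)
    · rwa [hFU n z h]
  have hFP' : ∀ n, ∀ z ∈ P, (F n).symm z ∈ P := fun n z hz => by
    by_cases h : z ∈ U
    · exact hUP ((mem_iff_of_fixed (symm_fixed (hFU n))).2 h)
    · rwa [symm_fixed (hFU n) z h]
  have hcau : ∀ (χ : X ≃ₜ X) (c : X), (∀ W ∈ 𝓝 c, ∀ᶠ n in atTop, ∀ x ∈ P, (χ ^ n) x ∈ W) →
      ∀ ε > 0, ∃ N : ℕ, ∀ x ∈ P, ∀ y ∈ P, dist ((χ ^ N) x) ((χ ^ N) y) < ε := by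
    intro χ c h ε hε
    obtain ⟨N, hN⟩ := (h _ (Metric.ball_mem_nhds c (half_pos hε))).exists
    refine ⟨N, fun x hx y hy => ?_⟩
    have h1 := Metric.mem_ball.1 (hN x hx)
    have h2 := Metric.mem_ball.1 (hN y hy)
    linarith [dist_triangle_right ((χ ^ N) x) ((χ ^ N) y) c]
  obtain ⟨G, hG⟩ := Homeomorph.exists_tendsto_of_cauchy F (by
    intro ε hε
    obtain ⟨N, hN⟩ := hcau ψ q hψ ε hε
    -- Later products can differ from `F N` only on (φ ^ N) '' P, and there both take values in the
    -- small set (ψ ^ N) '' P.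
    refine ⟨N, fun n hn z => ?_⟩
    obtain ⟨k, rfl⟩ := Nat.exists_eq_add_of_le hn
    obtain ⟨w, rfl⟩ := (φ ^ N).surjective z
    rw [hFadd, hFφ]
    by_cases hw : w ∈ P
    · rw [(hpow N _ (hFP k w hw)).1, (hpow N w hw).1]
      exact hN _ (hFP k w hw) _ hw
    · rwa [hFU k w fun h => hw (hUP h), dist_self]) (by
    intro ε hε
    obtain ⟨N, hN⟩ := hcau φ p hφ ε hε
    refine ⟨N, fun n hn z => ?_⟩
    obtain ⟨k, rfl⟩ := Nat.exists_eq_add_of_le hn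
    obtain ⟨v, rfl⟩ := ((g * φ) ^ N).surjective z
    have h1 : (F N).symm (((g * φ) ^ N) v) = (φ ^ N) v := by
      rw [Homeomorph.symm_apply_eq, hFφ]
    have h2 : (F (N + k)).symm (((g * φ) ^ N) v) = (φ ^ N) ((F k).symm v) := by
      rw [Homeomorph.symm_apply_eq, hFadd, Homeomorph.apply_symm_apply]
    rw [h1, h2]
    by_cases hv : v ∈ P
    · exact hN _ (hFP' k v hv) _ hv
    · rwa [symm_fixed (hFU k) v fun h => hv (hUP h), dist_self])
  refine ⟨G, ?_, fun z hz => tendsto_nhds_unique (hG z)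
    (tendsto_const_nhds.congr fun n => (hFU n z hz).symm)⟩
  have hpn : ∀ n, F n p = (ψ ^ n) p := fun n => by
    have : (φ ^ n) p = p := by
      induction n with
      | zero => rfl
      | succ n ih =>
        rw [pow_succ]
        change (φ ^ n) (φ p) = p
        rw [hφp, ih]
    rw [← (hpow n p hpP).1, ← hFφ, this]
  refine tendsto_nhds_unique (hG p) (tendsto_def.2 fun W hW => ?_)
  filter_upwards [hψ W hW] with n hn
  simpa only [mem_preimage, hpn] using hn p hpP

/-- Two radial structures that are interleaved at several levels have equivalent centers. -/
theorem RadialStructure.movesWithin {p q : X} (R : RadialStructure p) (S : RadialStructure q)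
    (h1 : ∀ x, R.rad x ≤ 1 → S.rad x ≤ 2) (h2 : ∀ x, S.rad x ≤ 4 → R.rad x ≤ 8)
    (h3 : ∀ x, R.rad x ≤ 16 → S.rad x ≤ 32) : MovesWithin {x | S.rad x ≤ 4} p q := by
  have e1 : ((8 : ℝ≥0) : ℝ≥0∞) = 8 := rfl
  have e2 : ((32 : ℝ≥0) : ℝ≥0∞) = 32 := rfl
  have e3 : ((2 : ℝ≥0) : ℝ≥0∞) = 2 := rfl
  have e816 : (8 : ℝ≥0∞) ≤ 16 := by norm_num
  have hmul : (8 : ℝ≥0∞) * 8⁻¹ = 1 := ENNReal.mul_inv_cancel (by simp) (by simp)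
  have hmul' : (32 : ℝ≥0∞) * 8⁻¹ = 4 := by
    rw [show (32 : ℝ≥0∞) = 4 * 8 by norm_num, mul_assoc, hmul, mul_one]
  let φ := R.shrink 8
  let ψ := S.shrink 32
  let l := S.shrink 2
  have hφ1 : ∀ z, R.rad z ≤ 8 → R.rad (φ z) ≤ 1 := fun z hz =>
    (R.rad_shrink_le 8 z hz).trans (hmul ▸ mul_le_mul_left hz _)
  have hψ4 : ∀ z, S.rad z ≤ 32 → S.rad (ψ z) ≤ 4 := fun z hz =>
    (S.rad_shrink_le 32 z hz).trans (hmul' ▸ mul_le_mul_left hz _)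
  have hφ16 : ∀ z, ¬ R.rad z ≤ 16 → φ z = z := fun z hz =>
    R.shrink_of_le 8 z (by rw [e1]; norm_num; exact (not_le.1 hz).le)
  have hl4 : ∀ z, ¬ S.rad z ≤ 4 → l z = z := fun z hz =>
    S.shrink_of_le 2 z (by rw [e3]; norm_num; exact (not_le.1 hz).le)
  -- On φ '' P the maps l and ψ agree, so g reduces to ψ ∘ φ⁻¹. Outside the S-ball of radius 4, l is
  -- the identity and ψ⁻¹ leads outside the R-ball of radius 16, where φ is the identity, so g is
  -- the identity too.
  refine MovesWithin.of_swindle φ ψ (ψ * φ⁻¹ * ψ⁻¹ * l) {x | R.rad x ≤ 8} {x | S.rad x ≤ 4} h2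
    (by simp [R.rad_self]) (R.shrink_self 8)
    (fun W hW => R.eventually_shrink_pow_mem 8 hW) (fun W hW => ?_) (fun z hz => ?_)
    (fun z hz => ?_) (fun z hz => (h1 _ (hφ1 z hz)).trans (by norm_num))
  · filter_upwards [S.eventually_shrink_pow_mem 32 hW] with n hn x hx
    exact hn x (h3 x (le_trans hx e816))
  · change ψ (φ.symm (ψ.symm (l z))) = z
    rw [hl4 z hz]
    have : φ (ψ.symm z) = ψ.symm z := hφ16 _ fun h => hz (by simpa using hψ4 _ (h3 _ h))
    rw [show φ.symm (ψ.symm z) = ψ.symm z from φ.symm_apply_eq.2 this.symm, ψ.apply_symm_apply]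
  · change ψ (φ.symm (ψ.symm (l (φ z)))) = ψ z
    have h2' := h1 _ (hφ1 z hz)
    have : l (φ z) = ψ (φ z) := S.shrink_congr 2 32 _ h2' (h2'.trans (by rw [e2]; norm_num))
    rw [this, ψ.symm_apply_apply, φ.symm_apply_apply]

end Swindle

/-! ### Strong local homogeneity by Baire category -/

/-- Finite unions of members of a countable basis suffice, by compactness. -/
theorem exists_countable_between_isCompact_isOpen (X : Type*) [TopologicalSpace X]
    [SecondCountableTopology X] :
    ∃ C : Set (Set X), C.Countable ∧
      ∀ K W : Set X, IsCompact K → IsOpen W → K ⊆ W → ∃ O ∈ C, K ⊆ O ∧ O ⊆ W := by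
  have hb := TopologicalSpace.isBasis_countableBasis X
  refine ⟨sUnion '' {s | s.Finite ∧ s ⊆ TopologicalSpace.countableBasis X},
    (countable_ofPred_finite_subset (TopologicalSpace.countable_countableBasis X)).image _,
    fun K W hK hW hKW => ?_⟩
  obtain ⟨t, ht, htf, hKt⟩ := hK.elim_finite_subcover_image
    (b := {s ∈ TopologicalSpace.countableBasis X | s ⊆ W}) (c := id)
    (fun s hs => hb.isOpen hs.1) (fun x hx => by
      obtain ⟨s, hs, hxs, hsW⟩ := hb.exists_subset_of_mem_open (hKW hx) hW
      exact mem_biUnion (show s ∈ {s ∈ TopologicalSpace.countableBasis X | s ⊆ W} from ⟨hs, hsW⟩) hxs)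
  refine ⟨⋃₀ t, ⟨t, ⟨htf, fun s hs => (ht hs).1⟩, rfl⟩, ?_, sUnion_subset fun s hs => (ht hs).2⟩
  rwa [sUnion_eq_biUnion]

theorem IsHomogeneousSpace.forall_mem_interior_closure {X : Type u} [TopologicalSpace X]
    (hhom : IsHomogeneousSpace X) {x₀ : X}
    (h : ∀ U : Set X, IsOpen U → x₀ ∈ U → x₀ ∈ interior (closure {y | MovesWithin U x₀ y})) :
    ∀ (U : Set X) (x : X), IsOpen U → x ∈ U → x ∈ interior (closure {y | MovesWithin U x y}) := by
  intro U x hU hx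
  obtain ⟨k, rfl⟩ := hhom x₀ x
  have h1 := h (k ⁻¹' U) (hU.preimage k.continuous) hx
  have h2 : k x₀ ∈ k '' interior (closure {y | MovesWithin (k ⁻¹' U) x₀ y}) := mem_image_of_mem k h1
  rw [k.image_interior, k.image_closure] at h2
  refine interior_mono (closure_mono ?_) h2
  rintro _ ⟨y, hy, rfl⟩
  exact MovesWithin.conj k hy

/-- A homogeneous space all of whose points carry arbitrarily small radial structures is strongly
locally homogeneous: there are only countably many ways in which the levels of radial structures
can interleave with a countable family of open sets, so Baire's theorem applies. -/
theorem isStronglyLocallyHomogeneous_of_radialStructure {X : Type u} [MetricSpace X]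
    [CompleteSpace X] [SecondCountableTopology X] (hhom : IsHomogeneousSpace X)
    (hR : ∀ (p : X), ∀ U ∈ 𝓝 p, ∃ R : RadialStructure p, ∀ x, R.rad x ≤ 32 → x ∈ U) :
    IsStronglyLocallyHomogeneous X := by
  rcases isEmpty_or_nonempty X with hX | hX
  · exact fun U x => (hX.false x).elim
  obtain ⟨C, hC, hCK⟩ := exists_countable_between_isCompact_isOpen X
  -- For R at p and S at q with the same witnesses, the balls satisfy R(1) ⊆ O₁ ⊆ S(2), S(4) ⊆ O₂ ⊆
  -- R(8) and R(16) ⊆ O₃ ⊆ S(32), as the swindle requires.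
  let P : Set X → Set X → Set X → Set X → Set X := fun U O₁ O₂ O₃ => {p | ∃ R : RadialStructure p,
    (∀ x, R.rad x ≤ 32 → x ∈ U) ∧
    (∀ x, R.rad x ≤ 1 → x ∈ O₁) ∧ (∀ x ∈ O₁, R.rad x ≤ 2) ∧
    (∀ x, R.rad x ≤ 4 → x ∈ O₂) ∧ (∀ x ∈ O₂, R.rad x ≤ 8) ∧
    (∀ x, R.rad x ≤ 16 → x ∈ O₃) ∧ (∀ x ∈ O₃, R.rad x ≤ 32)}
  have hPU : ∀ U O₁ O₂ O₃ p q, p ∈ P U O₁ O₂ O₃ → q ∈ P U O₁ O₂ O₃ → MovesWithin U p q := by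
    rintro U O₁ O₂ O₃ p q ⟨R, -, a1, -, -, a4, a5, -⟩ ⟨S, b0, -, b2, b3, -, -, b6⟩
    refine (R.movesWithin S (fun x hx => b2 x (a1 x hx)) (fun x hx => a4 x (b3 x hx))
      fun x hx => b6 x (a5 x hx)).mono fun x hx => b0 x (le_trans hx (by norm_num))
  have hbetween : ∀ {p : X} (R : RadialStructure p) (r s : ℝ≥0), r < s → ∃ O ∈ C,
      (∀ x, R.rad x ≤ r → x ∈ O) ∧ ∀ x ∈ O, R.rad x ≤ s := by
    intro p R r s hrs
    obtain ⟨O, hO, h1, h2⟩ := hCK {x | R.rad x ≤ r} {x | R.rad x < s} (R.isCompact_rad_le r)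
      (isOpen_lt R.continuous_rad continuous_const)
      fun x hx => lt_of_le_of_lt hx (ENNReal.coe_lt_coe.2 hrs)
    exact ⟨O, hO, fun x hx => h1 hx, fun x hx => le_of_lt (h2 hx)⟩
  have hcover : ∀ U ∈ TopologicalSpace.countableBasis X, ∀ p ∈ U,
      ∃ O₁ ∈ C, ∃ O₂ ∈ C, ∃ O₃ ∈ C, p ∈ P U O₁ O₂ O₃ := by
    intro U hU p hp
    obtain ⟨R, hRU⟩ := hR p U ((TopologicalSpace.isOpen_of_mem_countableBasis hU).mem_nhds hp)
    obtain ⟨O₁, h1, a1, b1⟩ := hbetween R 1 2 (by norm_num)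
    obtain ⟨O₂, h2, a2, b2⟩ := hbetween R 4 8 (by norm_num)
    obtain ⟨O₃, h3, a3, b3⟩ := hbetween R 16 32 (by norm_num)
    exact ⟨O₁, h1, O₂, h2, O₃, h3, R, hRU, a1, b1, a2, b2, a3, b3⟩
  have : Countable C := hC.to_subtype
  have : Countable (TopologicalSpace.countableBasis X) :=
    (TopologicalSpace.countable_countableBasis X).to_subtype
  -- The frontier of a closed set is nowhere dense. A point off all these frontiers is interior to
  -- the closure of each `P` containing it.
  obtain ⟨x₀, hx₀⟩ : ∃ x₀ : X, ∀ i : TopologicalSpace.countableBasis X × C × C × C,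
      x₀ ∉ frontier (closure (P i.1 i.2.1 i.2.2.1 i.2.2.2)) := by
    by_contra! hcon
    obtain ⟨i, x, hx⟩ := nonempty_interior_of_iUnion_of_closed
      (f := fun i : TopologicalSpace.countableBasis X × C × C × C =>
        frontier (closure (P i.1 i.2.1 i.2.2.1 i.2.2.2)))
      (fun i => isClosed_frontier) (by
        refine eq_univ_of_forall fun x => ?_
        obtain ⟨i, hi⟩ := hcon x
        exact mem_iUnion.2 ⟨i, hi⟩)
    rw [interior_frontier isClosed_closure] at hx
    exact hx
  refine isStronglyLocallyHomogeneous_of_mem_interior_closure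
    (hhom.forall_mem_interior_closure (x₀ := x₀) fun U hU hx => ?_)
  obtain ⟨V, hV, hxV, hVU⟩ :=
    (TopologicalSpace.isBasis_countableBasis X).exists_subset_of_mem_open hx hU
  obtain ⟨O₁, h1, O₂, h2, O₃, h3, hmem⟩ := hcover V hV x₀ hxV
  have hn := hx₀ ⟨⟨V, hV⟩, ⟨O₁, h1⟩, ⟨O₂, h2⟩, ⟨O₃, h3⟩⟩
  have hint : x₀ ∈ interior (closure (P V O₁ O₂ O₃)) := by
    by_contra hni
    refine hn ?_
    rw [isClosed_closure.frontier_eq]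
    exact ⟨subset_closure hmem, hni⟩
  refine interior_mono (closure_mono fun q hq => ?_) hint
  exact (hPU V O₁ O₂ O₃ x₀ q hmem hq).mono hVU

/-! ### The topology of the open cone -/

namespace OpenCone

variable {Y : Type u}

def vertex (Y : Type u) : OpenCone Y := Quotient.mk (openConeSetoid Y) (Sum.inr ())

def mk (y : Y) (t : ℝ≥0) : OpenCone Y := Quotient.mk (openConeSetoid Y) (Sum.inl (y, t))

theorem mk_zero (y : Y) : mk y 0 = vertex Y := Quotient.sound (Or.inr ⟨Or.inl ⟨y, rfl⟩, Or.inr rfl⟩)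

theorem ind {P : OpenCone Y → Prop} (hv : P (vertex Y)) (hmk : ∀ y t, P (mk y t)) (z) : P z := by
  induction z using Quotient.ind with
  | _ a =>
    rcases a with ⟨y, t⟩ | ⟨⟩
    · exact hmk y t
    · exact hv

/-- Functions on the cone are functions of `(y, t)` that are constant for `t = 0`. -/
def lift {Z : Type*} (f : Y → ℝ≥0 → Z) (v : Z) (hf : ∀ y, f y 0 = v) : OpenCone Y → Z :=
  Quotient.lift (Sum.elim (fun a => f a.1 a.2) fun _ => v) (by
    have : ∀ a ∈ openConeVertexSet Y, Sum.elim (fun a => f a.1 a.2) (fun _ => v) a = v := by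
      rintro _ (⟨y, rfl⟩ | rfl)
      · exact hf y
      · rfl
    rintro a b (rfl | ⟨ha, hb⟩)
    · rfl
    · rw [this a ha, this b hb])

def radius : OpenCone Y → ℝ≥0 := lift (fun _ t => t) 0 fun _ => rfl

@[simp] theorem radius_mk (y : Y) (t : ℝ≥0) : radius (mk y t) = t := rfl

@[simp] theorem radius_vertex : radius (vertex Y) = 0 := rfl

theorem radius_eq_zero_iff (z : OpenCone Y) : radius z = 0 ↔ z = vertex Y := by
  constructor
  · induction z using ind with
    | hv => exact fun _ => rfl
    | hmk y t =>
      rintro (rfl : t = 0)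
      exact mk_zero y
  · rintro rfl
    rfl

theorem mk_injective {y y' : Y} {t t' : ℝ≥0} (ht : t ≠ 0) (h : mk y t = mk y' t') :
    y = y' ∧ t = t' := by
  rcases Quotient.exact h with h | ⟨⟨y'', h⟩ | h, -⟩
  · simpa using h
  · simp only [Sum.inl.injEq, Prod.mk.injEq] at h
    exact (ht h.2).elim
  · exact (Sum.inl_ne_inr h).elim

/-- Reparametrization of the rays of a cone. -/
def reparam (ρ : ℝ≥0 → ℝ≥0) (hρ : ρ 0 = 0) : OpenCone Y → OpenCone Y :=
  lift (fun y t => mk y (ρ t)) (vertex Y) fun y => by rw [hρ, mk_zero]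

theorem radius_reparam (ρ : ℝ≥0 → ℝ≥0) (hρ : ρ 0 = 0) (z : OpenCone Y) :
    radius (reparam ρ hρ z) = ρ (radius z) := by
  induction z using ind with
  | hv => exact hρ.symm
  | hmk y t => rfl

theorem reparam_congr (ρ σ : ℝ≥0 → ℝ≥0) (hρ : ρ 0 = 0) (hσ : σ 0 = 0) (z : OpenCone Y)
    (h : ρ (radius z) = σ (radius z)) : reparam ρ hρ z = reparam σ hσ z := by
  induction z using ind with
  | hv => rfl
  | hmk y t => exact congrArg (mk y) h

theorem reparam_reparam (ρ σ : ℝ≥0 → ℝ≥0) (hρ : ρ 0 = 0) (hσ : σ 0 = 0) (z : OpenCone Y) :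
    reparam ρ hρ (reparam σ hσ z) = reparam (ρ ∘ σ) (by simp [hρ, hσ]) z := by
  induction z using ind with
  | hv => rfl
  | hmk y t => rfl

theorem reparam_id (ρ : ℝ≥0 → ℝ≥0) (hρ : ρ 0 = 0) (z : OpenCone Y) (h : ρ (radius z) = radius z) :
    reparam ρ hρ z = z := by
  induction z using ind with
  | hv => rfl
  | hmk y t => exact congrArg (mk y) h

variable [TopologicalSpace Y]

theorem continuous_mk : Continuous fun a : Y × ℝ≥0 => mk a.1 a.2 :=
  continuous_quot_mk.comp continuous_inl

theorem continuous_lift {Z : Type*} [TopologicalSpace Z] {f : Y → ℝ≥0 → Z} {v : Z}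
    (hf : ∀ y, f y 0 = v) (hc : Continuous fun a : Y × ℝ≥0 => f a.1 a.2) :
    Continuous (lift f v hf) :=
  Continuous.quotient_lift (continuous_sum_dom.2 ⟨hc, continuous_const⟩) _

theorem continuous_radius : Continuous (radius (Y := Y)) := continuous_lift _ continuous_snd

theorem continuous_reparam {ρ : ℝ≥0 → ℝ≥0} (hρ : ρ 0 = 0) (hc : Continuous ρ) :
    Continuous (reparam (Y := Y) ρ hρ) :=
  continuous_lift _ (continuous_mk.comp (continuous_fst.prodMk (hc.comp continuous_snd)))

def reparamHomeomorph (ρ : ℝ≥0 ≃ₜ ℝ≥0) (hρ : ρ 0 = 0) : OpenCone Y ≃ₜ OpenCone Y where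
  toFun := reparam ρ hρ
  invFun := reparam ρ.symm (by rw [Homeomorph.symm_apply_eq, hρ])
  left_inv z := by
    rw [reparam_reparam]
    exact reparam_id _ _ _ (ρ.symm_apply_apply _)
  right_inv z := by
    rw [reparam_reparam]
    exact reparam_id _ _ _ (ρ.apply_symm_apply _)
  continuous_toFun := continuous_reparam _ ρ.continuous
  continuous_invFun := continuous_reparam _ ρ.symm.continuous

theorem isCompact_radius_le [CompactSpace Y] (r : ℝ≥0) : IsCompact {z : OpenCone Y | radius z ≤ r} := by
  -- The vertex is listed separately because the product misses it when `Y` is empty.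
  have h : {z : OpenCone Y | radius z ≤ r} =
      {vertex Y} ∪ (fun a : Y × ℝ≥0 => mk a.1 a.2) '' (univ ×ˢ Icc 0 r) := by
    ext z
    induction z using ind with
    | hv => simp
    | hmk y t =>
      refine ⟨fun h => Or.inr ⟨(y, t), ⟨mem_univ _, zero_le, h⟩, rfl⟩, ?_⟩
      rintro (h | ⟨⟨y', t'⟩, ⟨-, -, h⟩, h'⟩)
      · rw [mem_singleton_iff] at h
        simp [h]
      · rw [← h']
        exact h
  rw [h]
  exact isCompact_singleton.union ((isCompact_univ.prod isCompact_Icc).image continuous_mk)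

theorem isPreconnected_radius_lt (r : ℝ≥0) :
    IsPreconnected {z : OpenCone Y | radius z < r} := by
  rcases eq_or_ne r 0 with rfl | hr
  · simpa using isPreconnected_empty
  refine isPreconnected_of_forall (vertex Y) fun z hz => ?_
  induction z using ind with
  | hv => exact ⟨{vertex Y}, by simpa using pos_iff_ne_zero.2 hr, rfl, rfl, isPreconnected_singleton⟩
  | hmk y t =>
    refine ⟨(fun s => mk y s) '' Iio r, ?_, ⟨0, pos_iff_ne_zero.2 hr, mk_zero y⟩, ⟨t, hz, rfl⟩,
      isPreconnected_Iio.image _ (continuous_mk.comp (continuous_const.prodMk continuous_id)).continuousOn⟩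
    rintro _ ⟨s, hs, rfl⟩
    exact hs

/-- Away from the vertex nothing is identified, so sets of points with positive radius are
saturated. -/
theorem isOpenEmbedding_mk :
    IsOpenEmbedding fun a : Y × Ioi (0 : ℝ≥0) => mk a.1 (a.2 : ℝ≥0) := by
  refine .of_continuous_injective_isOpenMap (continuous_mk.comp
    (continuous_fst.prodMk (continuous_subtype_val.comp continuous_snd))) ?_ ?_
  · rintro ⟨y, t, ht⟩ ⟨y', t', ht'⟩ h
    obtain ⟨rfl, h⟩ := mk_injective (ne_of_gt ht) h
    simpa using h
  · intro W hW
    have hq : IsQuotientMap (Quotient.mk (openConeSetoid Y)) := isQuotientMap_quot_mk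
    refine hq.isOpen_preimage.1 ?_
    have he : Quotient.mk (openConeSetoid Y) ⁻¹' ((fun a : Y × Ioi (0 : ℝ≥0) => mk a.1 (a.2 : ℝ≥0)) '' W)
        = Sum.inl '' ((fun a : Y × Ioi (0 : ℝ≥0) => (a.1, (a.2 : ℝ≥0))) '' W) := by
      ext a
      constructor
      · rintro ⟨⟨y, t, ht⟩, hw, h⟩
        rcases Quotient.exact h with h | ⟨⟨y'', h⟩ | h, -⟩
        · exact ⟨_, ⟨_, hw, rfl⟩, h⟩
        · simp only [Sum.inl.injEq, Prod.mk.injEq] at h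
          exact ((ne_of_gt ht) h.2).elim
        · exact (Sum.inl_ne_inr h).elim
      · rintro ⟨_, ⟨w, hw, rfl⟩, rfl⟩
        exact ⟨w, hw, rfl⟩
    refine (congrArg IsOpen he).mpr (isOpenMap_inl _ ?_)
    exact (IsOpenEmbedding.id.prodMap isOpen_Ioi.isOpenEmbedding_subtypeVal).isOpenMap _ hW

end OpenCone

/-! ### From cone charts to radial structures -/

/-- A homeomorphism of an open subspace that is the identity off a compact set extends by the
identity. -/
theorem Topology.IsOpenEmbedding.exists_homeomorph_extend {Z X : Type*} [TopologicalSpace Z]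
    [TopologicalSpace X] [T2Space X] {c : Z → X} (hc : IsOpenEmbedding c) (g : Z ≃ₜ Z) {K : Set Z}
    (hK : IsCompact K) (hg : ∀ z ∉ K, g z = z) :
    ∃ G : X ≃ₜ X, (∀ z, G (c z) = c (g z)) ∧ ∀ x ∉ range c, G x = x := by
  have key : ∀ g : Z ≃ₜ Z, (∀ z ∉ K, g z = z) →
      Continuous (Function.extend c (c ∘ g) id) := by
    intro g hg
    rw [continuous_iff_continuousAt]
    intro x
    by_cases hx : x ∈ range c
    · obtain ⟨z, rfl⟩ := hx
      rw [← hc.continuousAt_iff, Function.extend_comp hc.injective]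
      exact (hc.continuous.comp g.continuous).continuousAt
    · refine continuousAt_id.congr ?_
      filter_upwards [(hK.image hc.continuous).isClosed.isOpen_compl.mem_nhds
        fun h => hx (image_subset_range _ _ h)] with y hy
      by_cases hy' : y ∈ range c
      · obtain ⟨z, rfl⟩ := hy'
        rw [hc.injective.extend_apply, Function.comp_apply, hg z fun h => hy ⟨z, h, rfl⟩, id]
      · rw [Function.extend_apply' _ _ _ hy']
  have hinv : ∀ (g : Z ≃ₜ Z) x,
      Function.extend c (c ∘ g.symm) id (Function.extend c (c ∘ g) id x) = x := by
    intro g x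
    by_cases hx : x ∈ range c
    · obtain ⟨z, rfl⟩ := hx
      simp [hc.injective.extend_apply]
    · rw [Function.extend_apply' _ _ _ hx, id, Function.extend_apply' _ _ _ hx, id]
  refine ⟨⟨⟨_, _, hinv g, hinv g.symm⟩, key g hg, key g.symm fun z hz => ?_⟩,
    fun z => hc.injective.extend_apply _ _ z, fun x hx => Function.extend_apply' _ _ _ hx⟩
  rw [Homeomorph.symm_apply_eq, hg z hz]

/-- A homeomorphism of the half-line that is division by `8` on `[0, k]` and the identity on
`[2 * k, ∞)`. -/
theorem exists_homeomorph_div_eight (k : ℝ≥0) : ∃ ρ : ℝ≥0 ≃ₜ ℝ≥0,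
    (∀ r ≤ k, ρ r = r / 8) ∧ ∀ r, 2 * k ≤ r → ρ r = r := by
  rcases eq_or_ne k 0 with rfl | hk
  · refine ⟨Homeomorph.refl _, fun r hr => ?_, fun _ _ => rfl⟩
    obtain rfl : r = 0 := nonpos_iff_eq_zero.1 hr
    simp
  have hk3 : 0 < (2 * k) ^ 3 := by positivity
  -- The curve r * (r / (2 * k)) ^ 3 meets r / 8 at r = k and r at r = 2 * k, so it interpolates
  -- between the two lines.
  let f : ℝ≥0 → ℝ≥0 := fun r => max (r / 8) (min r (r ^ 4 / (2 * k) ^ 3))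
  have h1 : ∀ r ≤ k, f r = r / 8 := by
    intro r hr
    refine max_eq_left ((min_le_right _ _).trans ?_)
    rw [div_le_div_iff₀ hk3 (by norm_num)]
    calc r ^ 4 * 8 = r * (2 * r) ^ 3 := by ring
      _ ≤ r * (2 * k) ^ 3 := by gcongr
  have h2 : ∀ r, 2 * k ≤ r → f r = r := by
    intro r hr
    have : min r (r ^ 4 / (2 * k) ^ 3) = r := by
      refine min_eq_left ?_
      rw [le_div_iff₀ hk3]
      calc r * (2 * k) ^ 3 ≤ r * r ^ 3 := by gcongr
        _ = r ^ 4 := by ring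
    change max _ (min _ _) = r
    rw [this]
    exact max_eq_right (div_le_self zero_le (by norm_num))
  have hmono : StrictMono f := by
    intro r s hrs
    have a1 : r / 8 < s / 8 := by gcongr
    have a2 : r ^ 4 / (2 * k) ^ 3 < s ^ 4 / (2 * k) ^ 3 := by gcongr
    exact max_lt_max a1 (min_lt_min hrs a2)
  have hcont : Continuous f := by
    refine (continuous_id.div_const 8).max (continuous_id.min ?_)
    exact (continuous_pow 4).div_const _
  have hsurj : Function.Surjective f := by
    intro y
    refine mem_range_of_exists_le_of_exists_ge hcont ⟨0, ?_⟩ ⟨max y (2 * k), ?_⟩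
    · rw [h1 0 zero_le]
      simp
    · rw [h2 _ (le_max_right _ _)]
      exact le_max_left _ _
  exact ⟨(hmono.orderIsoOfSurjective f hsurj).toHomeomorph, h1, h2⟩

theorem Topology.IsOpenEmbedding.nonempty_radialStructure {X Y : Type*} [TopologicalSpace X]
    [T2Space X] [TopologicalSpace Y] [CompactSpace Y] {c : OpenCone Y → X}
    (hc : IsOpenEmbedding c) :
    ∃ R : RadialStructure (c (OpenCone.vertex Y)),
      ∀ x (r : ℝ≥0), R.rad x ≤ r → ∃ z, c z = x ∧ z.radius ≤ r := by
  choose ρ hρ1 hρ2 using exists_homeomorph_div_eight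
  have hρ0 : ∀ k, ρ k 0 = 0 := fun k => by rw [hρ1 k 0 zero_le, zero_div]
  have hext : ∀ k : ℝ≥0, ∃ G : X ≃ₜ X,
      (∀ z, G (c z) = c (OpenCone.reparamHomeomorph (ρ k) (hρ0 k) z)) ∧ ∀ x ∉ range c, G x = x :=
    fun k => hc.exists_homeomorph_extend (OpenCone.reparamHomeomorph (ρ k) (hρ0 k))
      (OpenCone.isCompact_radius_le (2 * k)) fun z hz =>
        OpenCone.reparam_id (ρ k) (hρ0 k) _ (hρ2 k _ (not_le.1 hz).le)
  choose G hG1 hG2 using hext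
  -- The value ⊤ off the chart is continuous because the finite sublevel sets are compact, hence
  -- closed in X.
  let rad : X → ℝ≥0∞ := Function.extend c (fun z => (z.radius : ℝ≥0∞)) fun _ => ⊤
  have hrad : ∀ z, rad (c z) = (z.radius : ℝ≥0∞) := fun z => hc.injective.extend_apply _ _ z
  have hrad' : ∀ x ∉ range c, rad x = ⊤ := fun x hx => Function.extend_apply' _ _ _ hx
  have hle : ∀ x (r : ℝ≥0), rad x ≤ r → ∃ z, c z = x ∧ z.radius ≤ r := by
    intro x r hx
    by_cases hxc : x ∈ range c
    · obtain ⟨z, rfl⟩ := hxc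
      exact ⟨z, rfl, by simpa [hrad] using hx⟩
    · rw [hrad' x hxc] at hx
      exact absurd hx (by simp)
  have hset : ∀ r : ℝ≥0, {x | rad x ≤ r} = c '' {z | z.radius ≤ r} := by
    intro r
    ext x
    constructor
    · intro hx
      obtain ⟨z, hz, hzr⟩ := hle x r hx
      exact ⟨z, hzr, hz⟩
    · rintro ⟨z, hz, rfl⟩
      simpa [hrad] using hz
  have hcomp : ∀ r : ℝ≥0, IsCompact {x | rad x ≤ r} := fun r => by
    rw [hset]
    exact (OpenCone.isCompact_radius_le r).image hc.continuous
  have hcont : Continuous rad := by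
    rw [continuous_iff_continuousAt]
    intro x
    by_cases hx : x ∈ range c
    · obtain ⟨z, rfl⟩ := hx
      rw [← hc.continuousAt_iff, Function.extend_comp hc.injective]
      exact (ENNReal.continuous_coe.comp OpenCone.continuous_radius).continuousAt
    · rw [ContinuousAt, hrad' x hx, ENNReal.tendsto_nhds_top_iff_nnreal]
      intro r
      filter_upwards [(hcomp r).isClosed.isOpen_compl.mem_nhds
        (show x ∉ {x | rad x ≤ r} by simp [hrad' x hx])] with y hy
      exact not_le.1 hy
  refine ⟨⟨rad, hcont, fun x => ?_, hcomp, G, fun k x hx => ?_, fun k x hx => ?_,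
    fun k k' x hx hx' => ?_⟩, hle⟩
  · constructor
    · intro h
      obtain ⟨z, rfl, hz⟩ := hle x 0 (by simp [h])
      rw [(OpenCone.radius_eq_zero_iff z).1 (nonpos_iff_eq_zero.1 hz)]
    · rintro rfl
      simp [hrad]
  · obtain ⟨z, rfl, hz⟩ := hle x k hx
    rw [hG1, hrad, hrad]
    change ((OpenCone.reparam (ρ k) (hρ0 k) z).radius : ℝ≥0∞) ≤ _
    rw [OpenCone.radius_reparam, hρ1 k _ hz, div_eq_mul_inv, ENNReal.coe_mul,
      ENNReal.coe_inv (by norm_num)]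
    rfl
  · by_cases hxc : x ∈ range c
    · obtain ⟨z, rfl⟩ := hxc
      rw [hG1]
      rw [hrad] at hx
      exact congrArg c (OpenCone.reparam_id (ρ k) (hρ0 k) _ (hρ2 k _ (by exact_mod_cast hx)))
    · exact hG2 k x hxc
  · obtain ⟨z, rfl, hz⟩ := hle x k hx
    obtain ⟨z', hzz, hz'⟩ := hle _ k' hx'
    obtain rfl := hc.injective hzz
    rw [hG1, hG1]
    exact congrArg c (OpenCone.reparam_congr (ρ k) (ρ k') (hρ0 k) (hρ0 k') _ (by rw [hρ1 k _ hz, hρ1 k' _ hz']))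

/-- Cone charts can be rescaled so that a large ball of the cone has small image. -/
theorem Topology.IsOpenEmbedding.exists_rescale {X Y : Type*} [TopologicalSpace X]
    [TopologicalSpace Y] [CompactSpace Y] {c : OpenCone Y → X} (hc : IsOpenEmbedding c)
    {U : Set X} (hU : U ∈ 𝓝 (c (OpenCone.vertex Y))) (s : ℝ≥0) (hs : s ≠ 0) :
    ∃ c' : OpenCone Y → X, IsOpenEmbedding c' ∧ c' (OpenCone.vertex Y) = c (OpenCone.vertex Y) ∧
      ∀ z, z.radius ≤ s → c' z ∈ U := by
  obtain ⟨ε, h0, hε⟩ := exists_forall_le_imp_mem_of_isCompact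
    (f := fun z : OpenCone Y => (z.radius : ℝ≥0∞)) (p := OpenCone.vertex Y)
    (ENNReal.continuous_coe.comp OpenCone.continuous_radius)
    (fun z hz => (OpenCone.radius_eq_zero_iff z).1 (by simpa using hz))
    (by simpa using OpenCone.isCompact_radius_le (Y := Y) 1) (hc.continuous.continuousAt hU)
  obtain ⟨δ, hδ0, hδ⟩ := ENNReal.lt_iff_exists_nnreal_btwn.1 h0
  have hδ0' : δ ≠ 0 := by
    rintro rfl
    simp at hδ0
  refine ⟨c ∘ OpenCone.reparamHomeomorph (Homeomorph.mulRight₀ (δ / s) (div_ne_zero hδ0' hs))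
    (by simp), hc.comp (Homeomorph.isOpenEmbedding _), rfl, fun z hz => hε _ ?_⟩
  change ((OpenCone.reparam (fun t => t * (δ / s)) (zero_mul _) z).radius : ℝ≥0∞) ≤ ε
  rw [OpenCone.radius_reparam]
  refine le_trans (ENNReal.coe_le_coe.2 ?_) hδ.le
  calc z.radius * (δ / s) ≤ s * (δ / s) := by gcongr
    _ = δ := mul_div_cancel₀ δ hs

theorem IsLocallyConical.exists_isOpenEmbedding {X : Type u} [TopologicalSpace X] [Nonempty X]
    (hlc : IsLocallyConical X) (hhom : IsHomogeneousSpace X) :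
    ∃ (Y : Type u) (_ : TopologicalSpace Y), CompactSpace Y ∧
      ∀ p : X, ∃ c : OpenCone Y → X, IsOpenEmbedding c ∧ c (OpenCone.vertex Y) = p := by
  obtain ⟨U, hU, -, Y, hY, hYc, ⟨e⟩⟩ := hlc (Classical.arbitrary X)
  refine ⟨Y, hY, hYc, fun p => ?_⟩
  obtain ⟨h, hh⟩ := hhom (e.symm (OpenCone.vertex Y)) p
  exact ⟨fun z => h (e.symm z), h.isOpenEmbedding.comp
    (hU.isOpenEmbedding_subtypeVal.comp e.symm.isOpenEmbedding), hh⟩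

/-! ### Nonseparating points -/

/-- Arbitrarily small neighborhoods of `p` remain connected when `p` is removed. -/
def LocallyNonseparating {X : Type*} [TopologicalSpace X] (p : X) : Prop :=
  ∀ U ∈ 𝓝 p, ∃ V ∈ 𝓝 p, V ⊆ U ∧ IsPreconnected (V \ {p})

section Nonseparating

variable {X : Type*} [TopologicalSpace X]

theorem LocallyNonseparating.map {p : X} (hp : LocallyNonseparating p) (h : X ≃ₜ X) :
    LocallyNonseparating (h p) := by
  intro U hU
  obtain ⟨V, hV, hVU, hc⟩ := hp (h ⁻¹' U) (h.continuous.continuousAt hU)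
  refine ⟨h '' V, h.isOpenMap.image_mem_nhds hV, image_subset_iff.2 hVU, ?_⟩
  rw [← image_singleton, ← image_sdiff h.injective]
  exact hc.image h h.continuous.continuousOn

/-- In a separation of the punctured set, the connected punctured neighborhood lies on one side.
Adding p to that side would separate `W` itself. -/
theorem LocallyNonseparating.isPreconnected_diff [T1Space X] {p : X} (hp : LocallyNonseparating p)
    {W : Set X} (hW : IsOpen W) (hc : IsPreconnected W) : IsPreconnected (W \ {p}) := by
  by_cases hpW : p ∈ W
  swap
  · rwa [sdiff_singleton_eq_self hpW]
  obtain ⟨V, hV, hVW, hVc⟩ := hp W (hW.mem_nhds hpW)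
  rw [isPreconnected_iff_subset_of_disjoint]
  have key : ∀ A B : Set X, IsOpen A → IsOpen B → W \ {p} ⊆ A ∪ B → W \ {p} ∩ (A ∩ B) = ∅ →
      V \ {p} ⊆ A → W \ {p} ⊆ A ∨ W \ {p} ⊆ B := by
    intro A B hA hB hAB hdisj hVA
    have h1 := isPreconnected_iff_subset_of_disjoint.1 hc (A ∪ interior V) (B \ {p})
      (hA.union isOpen_interior) (hB.sdiff isClosed_singleton) (by
        intro x hx
        by_cases hxp : x = p
        · exact Or.inl (Or.inr (hxp ▸ mem_interior_iff_mem_nhds.2 hV))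
        · rcases hAB ⟨hx, hxp⟩ with h | h
          · exact Or.inl (Or.inl h)
          · exact Or.inr ⟨h, hxp⟩) (by
        rw [eq_empty_iff_forall_notMem]
        rintro x ⟨hxW, hxA, hxB, hxp⟩
        refine eq_empty_iff_forall_notMem.1 hdisj x ⟨⟨hxW, hxp⟩, ?_, hxB⟩
        exact hxA.elim id fun h => hVA ⟨interior_subset h, hxp⟩)
    rcases h1 with h1 | h1
    · left
      rintro x ⟨hxW, hxp⟩
      exact (h1 hxW).elim id fun h => hVA ⟨interior_subset h, hxp⟩
    · exact Or.inr fun x hx => (h1 hx.1).1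
  intro A B hA hB hAB hdisj
  have hVd : V \ {p} ⊆ W \ {p} := sdiff_subset_sdiff_left hVW
  rcases isPreconnected_iff_subset_of_disjoint.1 hVc A B hA hB (hVd.trans hAB)
    (subset_empty_iff.1 (hdisj ▸ inter_subset_inter_left _ hVd)) with h | h
  · exact key A B hA hB hAB hdisj h
  · exact (key B A hB hA (union_comm A B ▸ hAB) (inter_comm A B ▸ hdisj) h).symm

theorem isPreconnected_compl_of_finite [T1Space X] [PreconnectedSpace X]
    (h : ∀ p : X, LocallyNonseparating p) {F : Set X} (hF : F.Finite) : IsPreconnected Fᶜ := by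
  induction F, hF using Set.Finite.induction_on with
  | empty => simpa using isPreconnected_univ
  | @insert a s _ hs ih =>
    have : (insert a s)ᶜ = sᶜ \ {a} := by
      ext x
      simp [not_or, and_comm]
    rw [this]
    exact (h a).isPreconnected_diff hs.isClosed.isOpen_compl ih

/-- A cross, the union of a column other than y and a row other than t, is connected and avoids (y,
t). Every remaining point shares such a cross with (y', t'). -/
theorem IsPreconnected.prod_diff_singleton {Y Z : Type*} [TopologicalSpace Y] [TopologicalSpace Z]
    {N : Set Y} {I : Set Z} (hN : IsPreconnected N) (hI : IsPreconnected I) {y y' : Y} {t t' : Z}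
    (hy' : y' ∈ N) (ht' : t' ∈ I) (hyy : y' ≠ y) (htt : t' ≠ t) :
    IsPreconnected (N ×ˢ I \ {(y, t)}) := by
  have hrow : ∀ s, IsPreconnected (N ×ˢ ({s} : Set Z)) := fun s => hN.prod isPreconnected_singleton
  have hcol : ∀ a, IsPreconnected (({a} : Set Y) ×ˢ I) := fun a => isPreconnected_singleton.prod hI
  have hcross : ∀ a ∈ N, ∀ s ∈ I, IsPreconnected (({a} : Set Y) ×ˢ I ∪ N ×ˢ ({s} : Set Z)) :=
    fun a ha s hs => (hcol a).union (a, s) ⟨rfl, hs⟩ ⟨ha, rfl⟩ (hrow s)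
  have hsub : ∀ a ∈ N, ∀ s ∈ I, a ≠ y → s ≠ t →
      ({a} : Set Y) ×ˢ I ∪ N ×ˢ ({s} : Set Z) ⊆ N ×ˢ I \ {(y, t)} := by
    rintro a ha s hs hay hst ⟨b, r⟩ (⟨rfl, hr⟩ | ⟨hb, rfl⟩)
    · exact ⟨⟨ha, hr⟩, fun h => hay (congrArg Prod.fst h)⟩
    · exact ⟨⟨hb, hs⟩, fun h => hst (congrArg Prod.snd h)⟩
  refine isPreconnected_of_forall (y', t') ?_
  rintro ⟨a, s⟩ ⟨⟨ha, hs⟩, hne⟩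
  by_cases hay : a = y
  · have hst : s ≠ t := fun h => hne (by rw [hay, h]; rfl)
    exact ⟨_, hsub y' hy' s hs hyy hst, Or.inl ⟨rfl, ht'⟩, Or.inr ⟨ha, rfl⟩, hcross y' hy' s hs⟩
  · exact ⟨_, hsub a ha t' ht' hay htt, Or.inr ⟨hy', rfl⟩, Or.inl ⟨rfl, hs⟩, hcross a ha t' ht'⟩

end Nonseparating

/-! ### Extending finite bijections -/

/-- Points are placed one at a time: the complement of the targets already reached is open and
connected, hence a single orbit of maps fixing those targets. -/
theorem IsStronglyLocallyHomogeneous.isStronglyHomogeneous {X : Type u} [TopologicalSpace X]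
    [T1Space X] (hs : IsStronglyLocallyHomogeneous X)
    (hc : ∀ F : Set X, F.Finite → IsPreconnected Fᶜ) (n : ℕ) : IsStronglyHomogeneous n X := by
  classical
  intro A B _ _ f
  suffices h : ∀ S : Finset A, ∃ h : X ≃ₜ X, ∀ a ∈ S, h a = f a by
    obtain ⟨h, hh⟩ := h Finset.univ
    exact ⟨h, fun a => hh a (Finset.mem_univ a)⟩
  intro S
  induction S using Finset.induction_on with
  | empty => exact ⟨Homeomorph.refl X, by simp⟩
  | insert a S ha ih =>
    obtain ⟨h, hh⟩ := ih
    let F : Set X := (fun b : A => (f b : X)) '' S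
    have hF : F.Finite := S.finite_toSet.image _
    have h1 : h a ∈ Fᶜ := by
      rintro ⟨b, hb, hba⟩
      have := h.injective ((hh b hb).trans hba)
      exact ha (Subtype.ext this ▸ hb)
    have h2 : (f a : X) ∈ Fᶜ := by
      rintro ⟨b, hb, hba⟩
      exact ha (f.injective (Subtype.ext hba) ▸ hb)
    obtain ⟨k, hk, hkF⟩ := MovesWithin.of_isPreconnected hs hF.isClosed.isOpen_compl (hc F hF) h1 h2
    refine ⟨h.trans k, fun b hb => ?_⟩
    rcases Finset.mem_insert.1 hb with rfl | hb
    · exact hk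
    · rw [Homeomorph.trans_apply, hh b hb]
      exact hkF _ (not_not.2 ⟨b, hb, rfl⟩)

/-! ### The dichotomy between 1-manifolds and nonseparating points -/

theorem isOneManifold_of_forall_isOpenEmbedding {X : Type u} [TopologicalSpace X] [T2Space X]
    [SecondCountableTopology X] (h : ∀ x : X, ∃ f : ℝ → X, IsOpenEmbedding f ∧ x ∈ range f) :
    IsOneManifold X := by
  choose f hf hx using h
  exact ⟨inferInstance, inferInstance, ⟨{
    atlas := range fun x => ((hf x).toOpenPartialHomeomorph (f x)).symm
    chartAt := fun x => ((hf x).toOpenPartialHomeomorph (f x)).symm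
    mem_chart_source := fun x => by simpa using hx x
    chart_mem_atlas := fun x => mem_range_self x }⟩⟩

theorem exists_isOpenEmbedding_real_openCone {Y : Type*} [TopologicalSpace Y] {y : Y}
    (hy : IsOpen {y}) : ∃ f : ℝ → OpenCone Y, IsOpenEmbedding f := by
  let e : ℝ ≃ₜ Ioi (0 : ℝ≥0) :=
    { toFun := fun t => ⟨⟨Real.exp t, (Real.exp_pos t).le⟩, Real.exp_pos t⟩
      invFun := fun s => Real.log (s : ℝ≥0)
      left_inv := fun t => Real.log_exp t
      right_inv := fun s => Subtype.ext (NNReal.eq (Real.exp_log s.2))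
      continuous_toFun := (Real.continuous_exp.subtype_mk _).subtype_mk _
      continuous_invFun := Continuous.log (NNReal.continuous_coe.comp continuous_subtype_val)
        fun s => ne_of_gt (show (0 : ℝ) < ((s : ℝ≥0) : ℝ) from s.2) }
  have hslice : IsOpenEmbedding fun s : Ioi (0 : ℝ≥0) => (y, s) := by
    refine .of_continuous_injective_isOpenMap (by fun_prop) (fun a b h => congrArg Prod.snd h)
      fun W hW => ?_
    have : (fun s : Ioi (0 : ℝ≥0) => (y, s)) '' W = {y} ×ˢ W := by
      rw [singleton_prod]
    rw [this]
    exact hy.prod hW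
  exact ⟨_, OpenCone.isOpenEmbedding_mk.comp (hslice.comp e.isOpenEmbedding)⟩

/-- The point has a product neighborhood from the chart `c`, while being also a vertex (`hq`) it has
small connected neighborhoods. Together these give connected product neighborhoods, although `Y` is
not assumed locally connected. -/
theorem Topology.IsOpenEmbedding.locallyNonseparating_mk {X Y : Type*} [TopologicalSpace X]
    [TopologicalSpace Y] [CompactSpace Y] {c : OpenCone Y → X} (hc : IsOpenEmbedding c) {y : Y}
    (hy : ¬ IsOpen {y})
    (hq : ∃ c' : OpenCone Y → X, IsOpenEmbedding c' ∧ c' (OpenCone.vertex Y) = c (OpenCone.mk y 1)) :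
    LocallyNonseparating (c (OpenCone.mk y 1)) := by
  intro U hU
  let e : Y × Ioi (0 : ℝ≥0) → X := fun a => c (OpenCone.mk a.1 a.2)
  have he : IsOpenEmbedding e := hc.comp OpenCone.isOpenEmbedding_mk
  let t : Ioi (0 : ℝ≥0) := ⟨1, mem_Ioi.2 one_pos⟩
  obtain ⟨M, hM, J, hJ, hMJ⟩ := mem_nhds_prod_iff.1 (he.continuous.continuousAt (x := (y, t)) hU)
  have hMJn : e '' (M ×ˢ J) ∈ 𝓝 (c (OpenCone.mk y 1)) :=
    he.isOpenMap.image_mem_nhds (x := (y, t)) (prod_mem_nhds hM hJ)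
  obtain ⟨c₀, hc₀, hc₀q⟩ := hq
  obtain ⟨c', hc', hc'q, hsmall⟩ := hc₀.exists_rescale (hc₀q.symm ▸ hMJn) 1 one_ne_zero
  let W' : Set X := c' '' {z | z.radius < 1}
  have hW'o : IsOpen W' :=
    hc'.isOpenMap _ (isOpen_lt OpenCone.continuous_radius continuous_const)
  have hW'c : IsPreconnected W' :=
    (OpenCone.isPreconnected_radius_lt 1).image _ hc'.continuous.continuousOn
  have hqW' : e (y, t) ∈ W' := ⟨OpenCone.vertex Y, show (0 : ℝ≥0) < 1 from one_pos, hc'q.trans hc₀q⟩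
  have hW'MJ : W' ⊆ e '' (M ×ˢ J) := image_subset_iff.2 fun z hz => hsmall z (le_of_lt hz)
  let W : Set (Y × Ioi (0 : ℝ≥0)) := e ⁻¹' W'
  have hWW' : e '' W = W' :=
    image_preimage_eq_of_subset (hW'MJ.trans (image_subset_range _ _))
  have hWc : IsPreconnected W := he.isInducing.isPreconnected_image.1 (hWW' ▸ hW'c)
  have hWo : IsOpen W := hW'o.preimage he.continuous
  have hyW : (y, t) ∈ W := hqW'
  have hWMJ : W ⊆ M ×ˢ J := fun a ha => by
    obtain ⟨b, hb, hab⟩ := hW'MJ ha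
    exact he.injective hab ▸ hb
  -- The connected set `W` need not be a product, but its projections are open and connected, and
  -- their product still lies in `M ×ˢ J`.
  let N : Set Y := Prod.fst '' W
  let I : Set (Ioi (0 : ℝ≥0)) := Prod.snd '' W
  have hNo : IsOpen N := isOpenMap_fst _ hWo
  have hIo : IsOpen I := isOpenMap_snd _ hWo
  have hyN : y ∈ N := ⟨_, hyW, rfl⟩
  have htI : t ∈ I := ⟨_, hyW, rfl⟩
  obtain ⟨y', hy', hyy⟩ : ∃ y' ∈ N, y' ≠ y := by
    by_contra! hcon
    refine hy ?_
    rwa [← (eq_singleton_iff_unique_mem.2 ⟨hyN, hcon⟩ : N = {y})]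
  obtain ⟨t', ht', htt⟩ : ∃ t' ∈ I, t' ≠ t := by
    by_contra! hcon
    have h1 : IsOpen ({1} : Set ℝ≥0) := by
      have := isOpen_Ioi.isOpenMap_subtype_val _ hIo
      rwa [(eq_singleton_iff_unique_mem.2 ⟨htI, hcon⟩ : I = {t}), image_singleton] at this
    exact not_isOpen_singleton 1 h1
  have hNI : IsPreconnected (N ×ˢ I \ {(y, t)}) :=
    (hWc.image _ continuous_fst.continuousOn).prod_diff_singleton
      (hWc.image _ continuous_snd.continuousOn) hy' ht' hyy htt
  refine ⟨e '' (N ×ˢ I), he.isOpenMap.image_mem_nhds (x := (y, t))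
    ((hNo.prod hIo).mem_nhds ⟨hyN, htI⟩), ?_, ?_⟩
  · rw [image_subset_iff]
    refine Subset.trans (prod_mono ?_ ?_) hMJ
    · exact image_subset_iff.2 fun a ha => (hWMJ ha).1
    · exact image_subset_iff.2 fun a ha => (hWMJ ha).2
  · rw [show ({c (OpenCone.mk y 1)} : Set X) = e '' {(y, t)} from (image_singleton (f := e) (a := (y, t))).symm,
      ← image_sdiff he.injective]
    exact hNI.image _ he.continuous.continuousOn

theorem Topology.IsOpenEmbedding.locallyNonseparating_vertex {X Y : Type*} [TopologicalSpace X]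
    [TopologicalSpace Y] [IsEmpty Y] {c : OpenCone Y → X} (hc : IsOpenEmbedding c) :
    LocallyNonseparating (c (OpenCone.vertex Y)) := by
  intro U hU
  refine ⟨{c (OpenCone.vertex Y)}, ?_, singleton_subset_iff.2 (mem_of_mem_nhds hU), by
    simpa using isPreconnected_empty⟩
  have : range c = {c (OpenCone.vertex Y)} := by
    refine Subset.antisymm ?_ (singleton_subset_iff.2 (mem_range_self _))
    rintro _ ⟨z, rfl⟩
    induction z using OpenCone.ind with
    | hv => rfl
    | hmk y t => exact isEmptyElim y
  rw [← this]
  exact hc.isOpen_range.mem_nhds (mem_range_self _)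

/-- In a homogeneous locally conical space that is not a 1-manifold, points do not separate their
small neighborhoods. -/
theorem IsLocallyConical.locallyNonseparating {X : Type u} [TopologicalSpace X] [T2Space X]
    [SecondCountableTopology X] (hlc : IsLocallyConical X) (hhom : IsHomogeneousSpace X)
    (hX : ¬ IsOneManifold X) (p : X) : LocallyNonseparating p := by
  have : Nonempty X := ⟨p⟩
  obtain ⟨Y, _, _, hY⟩ := hlc.exists_isOpenEmbedding hhom
  suffices h : ∃ q : X, LocallyNonseparating q by
    obtain ⟨q, hq⟩ := h
    obtain ⟨k, rfl⟩ := hhom q p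
    exact hq.map k
  obtain ⟨c, hc, -⟩ := hY p
  rcases isEmpty_or_nonempty Y with hYe | ⟨⟨y⟩⟩
  · exact ⟨_, hc.locallyNonseparating_vertex⟩
  by_cases hy : IsOpen {y}
  · obtain ⟨f, hf⟩ := exists_isOpenEmbedding_real_openCone hy
    refine (hX (isOneManifold_of_forall_isOpenEmbedding fun x => ?_)).elim
    obtain ⟨k, hk⟩ := hhom (c (f 0)) x
    exact ⟨fun t => k (c (f t)), k.isOpenEmbedding.comp (hc.comp hf), 0, hk⟩
  · exact ⟨_, hc.locallyNonseparating_mk hy (hY _)⟩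

/-! ### Assembly -/

theorem IsLocallyConical.exists_radialStructure {X : Type u} [TopologicalSpace X] [T2Space X]
    (hlc : IsLocallyConical X) (hhom : IsHomogeneousSpace X) (p : X) {U : Set X} (hU : U ∈ 𝓝 p) :
    ∃ R : RadialStructure p, ∀ x, R.rad x ≤ 32 → x ∈ U := by
  have : Nonempty X := ⟨p⟩
  obtain ⟨Y, _, _, hY⟩ := hlc.exists_isOpenEmbedding hhom
  obtain ⟨c₀, hc₀, hp⟩ := hY p
  obtain ⟨c, hc, hcc, hsmall⟩ := hc₀.exists_rescale (hp.symm ▸ hU) 32 (by norm_num)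
  obtain rfl := hcc.trans hp
  obtain ⟨R, hR⟩ := hc.nonempty_radialStructure
  refine ⟨R, fun x hx => ?_⟩
  obtain ⟨z, rfl, hz⟩ := hR x 32 hx
  exact hsmall z hz

theorem IsLocallyConical.locallyCompactSpace {X : Type u} [TopologicalSpace X] [T2Space X]
    (hlc : IsLocallyConical X) (hhom : IsHomogeneousSpace X) : LocallyCompactSpace X := by
  have : WeaklyLocallyCompactSpace X := ⟨fun p => by
    obtain ⟨R, -⟩ := hlc.exists_radialStructure hhom p univ_mem
    refine ⟨_, R.isCompact_rad_le 1, ?_⟩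
    filter_upwards [R.continuous_rad.continuousAt.eventually
      (gt_mem_nhds (show R.rad p < 1 by simp [R.rad_self]))] with x hx
    exact hx.le⟩
  infer_instance

theorem IsLocallyConical.isStronglyLocallyHomogeneous {X : Type u} [TopologicalSpace X]
    [PolishSpace X] (hlc : IsLocallyConical X) (hhom : IsHomogeneousSpace X) :
    IsStronglyLocallyHomogeneous X := by
  let := TopologicalSpace.upgradeIsCompletelyMetrizable X
  exact isStronglyLocallyHomogeneous_of_radialStructure hhom
    fun p _ hU => hlc.exists_radialStructure hhom p hU

theorem IsStronglyLocallyHomogeneous.isCountableDenseHomogeneous_of_polishSpace {X : Type u}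
    [TopologicalSpace X] [PolishSpace X] (hs : IsStronglyLocallyHomogeneous X) :
    IsCountableDenseHomogeneous X := by
  let := TopologicalSpace.upgradeIsCompletelyMetrizable X
  exact hs.isCountableDenseHomogeneous

theorem mainTheorem1 (X : Type u) [MetricSpace X] [TopologicalSpace.SeparableSpace X]
    (hhom : IsHomogeneousSpace X) (hlc : IsLocallyConical X) :
    (ConnectedSpace X → ¬ IsOneManifold X → ∀ n : ℕ, 2 ≤ n → IsStronglyHomogeneous n X) ∧
      IsCountableDenseHomogeneous X := by
  have := hlc.locallyCompactSpace hhom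
  have := polishSpace_of_locallyCompact X
  have hs := hlc.isStronglyLocallyHomogeneous hhom
  refine ⟨fun hconn hX n _ => hs.isStronglyHomogeneous (fun F hF =>
    isPreconnected_compl_of_finite (hlc.locallyNonseparating hhom hX) hF) n,
    hs.isCountableDenseHomogeneous_of_polishSpace⟩
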